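/- Let $\mathbb{F}$ be a field of characteristic $0$, let $p$ be a prime number, and let $K$ be a finite group. Let $\mathbb{F}B_K$ be the shifted Burnside functor: $\mathbb{F}B_K(G)=\mathbb{F}\otimes_{\mathbb{Z}}B(G\times K)$ for a finite group $G$, where $B(-)$ is the Grothendieck group of finite sets with group action; a finite $(H,G)$-biset $U$ acts by $\mathbb{F}B_K(U)=\mathbb{F}B(U\times K)$, where $U\times K$ is the $(H\times K,G\times K)$-biset on which $K$ acts on both sides of the second component by multiplication; and the product $\mathbb{F}B_K(G)\times\mathbb{F}B_K(H)\to\mathbb{F}B_K(G\times H)$ is the external product to $\mathbb{F}B(G\times K\times H\times K)$ followed by restriction along $(g,h,k)\mapsto(g,k,h,k)$. An ideal $I$ of $\mathbb{F}B_K$ is a family of subspaces $I(G)\subseteq \mathbb{F}B_K(G)$, for all finite groups $G$, stable under all finite bisets and under multiplication by elements of $\mathbb{F}B_K$. For a subgroup $X$ of a finite group $G$, put $$e_X^{G}=\frac{1}{|N_{G}(X)|}\sum_{Y\leq X}|Y|\,\mu(Y,X)\,[G/Y]\in\mathbb{F}B(G),$$ where $\mu$ is the Möbius function of the poset of subgroups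 of $G$. For a group $(L,\varphi)$ over $K$, i.e. a finite group $L$ with a homomorphism $\varphi:L\to K$, let $\mathsf{e}_{L,\varphi}$ be the ideal of $\mathbb{F}B_K$ generated by $e_{L_\varphi}^{L\times K}\in\mathbb{F}B_K(L)$, where $L_\varphi=\{(l,\varphi(l))\mid l\in L\}$. Say that $(L,\varphi)$ is $p$-persistent if $\mathsf{e}_{L,\varphi}(P)\neq\{0\}$ for some finite $p$-group $P$. For a normal subgroup $N$ of $L$ let $$m_{L,N}=\frac{1}{|L|}\sum_{\substack{X\leq L\\ XN=L}}|X|\,\mu(X,L).$$ Say that $(L,\varphi)$ is a $B_K$-group if $m_{L,N}=0$ for every non-trivial normal subgroup $N$ of $L$ contained in $\ker\varphi$. Let $O^p(L)$ be the subgroup of $L$ generated by the elements of order prime to $p$. Then, for every group $(L,\varphi)$ over $K$, the following conditions are equivalent: (i) $(L,\varphi)$ is $p$-persistent; (ii) $\mathsf{e}_{L,\varphi}\big(L/O^p(L)\big)\neq\{0\}$; (iii) $m_{L,\,O^p(L)\cap\ker\varphi}\neq 0$. Moreover, if $(L,\varphi)$ is a $p$-persistent $B_K$-group, then $O^p(L)\cap\ker\varphi=\mathbf{1}$.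 -/

import Mathlib

universe u v

namespace RelBGroup

/-! ### Finite sets with a group action, and finite bisets -/

/-- A finite (left) `G`-set. -/
structure FinGSet (G : Type u) [Group G] : Type (u + 1) where
  carrier : Type u
  [action : MulAction G carrier]
  [finite : Finite carrier]

attribute [instance] FinGSet.action FinGSet.finite

/-- A finite `(H, G)`-biset: commuting left `H`-action and right `G`-action. -/
structure FinBiset (H G : Type u) [Group H] [Group G] : Type (u + 1) where
  carrier : Type u
  [left : MulAction H carrier]
  [right : MulAction Gᵐᵒᵖ carrier]
  [comm : SMulCommClass H Gᵐᵒᵖ carrier]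
  [finite : Finite carrier]

attribute [instance] FinBiset.left FinBiset.right FinBiset.comm FinBiset.finite

namespace FinGSet

/-- Isomorphism of `G`-sets. -/
def Iso {G : Type u} [Group G] (X Y : FinGSet G) : Prop :=
  ∃ f : X.carrier ≃ Y.carrier, ∀ (g : G) (x : X.carrier), f (g • x) = g • f x

/-- Disjoint union of `G`-sets. -/
def sum {G : Type u} [Group G] (X Y : FinGSet G) : FinGSet G where
  carrier := X.carrier ⊕ Y.carrier

/-- The transitive `G`-set `G / X`. -/
def coset {G : Type u} [Group G] [Finite G] (X : Subgroup G) : FinGSet G where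
  carrier := G ⧸ X

/-- Restriction of a `B`-set along a group homomorphism `A → B`. -/
def res {A B : Type u} [Group A] [Group B] (f : A →* B) (X : FinGSet B) : FinGSet A where
  carrier := X.carrier
  action := MulAction.compHom X.carrier f

/-- The `A × B`-set `X × Y`, for an `A`-set `X` and a `B`-set `Y`. -/
def prod {A B : Type u} [Group A] [Group B] (X : FinGSet A) (Y : FinGSet B) :
    FinGSet (A × B) where
  carrier := X.carrier × Y.carrier
  action :=
    { smul := fun g z => (g.1 • z.1, g.2 • z.2)
      one_smul := fun z => Prod.ext (one_smul A z.1) (one_smul B z.2)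
      mul_smul := fun g h z => Prod.ext (mul_smul g.1 h.1 z.1) (mul_smul g.2 h.2 z.2) }

end FinGSet

namespace FinBiset

/-- The equivalence relation on `U × X` whose quotient is `U ×_G X`: the orbit relation of `G`
acting by `(u, x) · g = (u g, g⁻¹ x)`. -/
def tensorSetoid {H G : Type u} [Group H] [Group G] (U : FinBiset H G) (X : FinGSet G) :
    Setoid (U.carrier × X.carrier) where
  r a b := ∃ g : G, b = (MulOpposite.op g • a.1, g⁻¹ • a.2)
  iseqv :=
    { refl := fun a => ⟨1, by simp⟩
      symm := by
        rintro a b ⟨g, rfl⟩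
        exact ⟨g⁻¹, by simp [smul_smul]⟩
      trans := by
        rintro a b c ⟨g, rfl⟩ ⟨h, rfl⟩
        exact ⟨g * h, by simp [smul_smul, ← MulOpposite.op_mul]⟩ }

/-- The `H`-set `U ×_G X`. -/
def tensor {H G : Type u} [Group H] [Group G] (U : FinBiset H G) (X : FinGSet G) :
    FinGSet H where
  carrier := Quotient (U.tensorSetoid X)
  action :=
    { smul := fun h => Quotient.map (fun a => (h • a.1, a.2)) (by
        rintro a b ⟨g, rfl⟩
        exact ⟨g, Prod.ext (smul_comm h (MulOpposite.op g) a.1) rfl⟩)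
      one_smul := by
        rintro ⟨a⟩
        exact congrArg (Quotient.mk _) (Prod.ext (one_smul H a.1) rfl)
      mul_smul := by
        rintro h k ⟨a⟩
        exact congrArg (Quotient.mk _) (Prod.ext (mul_smul h k a.1) rfl) }

/-- The action `(h, k) · (u, c) = (h u, k c)` of `H × K` on `U × K`. -/
@[reducible] def prodLeft {H G : Type u} [Group H] [Group G] (U : FinBiset H G)
    (K : Type u) [Group K] : MulAction (H × K) (U.carrier × K) where
  smul h z := (h.1 • z.1, h.2 * z.2)
  one_smul z := Prod.ext (one_smul H z.1) (one_mul z.2)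
  mul_smul g h z := Prod.ext (mul_smul g.1 h.1 z.1) (mul_assoc g.2 h.2 z.2)

/-- The right action `(u, c) · (g, k) = (u g, c k)` of `G × K` on `U × K`. -/
@[reducible] def prodRight {H G : Type u} [Group H] [Group G] (U : FinBiset H G)
    (K : Type u) [Group K] : MulAction (G × K)ᵐᵒᵖ (U.carrier × K) where
  smul g z := (MulOpposite.op g.unop.1 • z.1, z.2 * g.unop.2)
  one_smul z := Prod.ext (one_smul Gᵐᵒᵖ z.1) (mul_one z.2)
  mul_smul g h z := Prod.ext
    (mul_smul (MulOpposite.op g.unop.1) (MulOpposite.op h.unop.1) z.1)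
    (mul_assoc z.2 h.unop.2 g.unop.2).symm

/-- The `(H × K, G × K)`-biset `U × K`, where `K` acts on both sides of the second component by
multiplication. -/
def prodGroup {H G : Type u} [Group H] [Group G] (U : FinBiset H G)
    (K : Type u) [Group K] [Finite K] : FinBiset (H × K) (G × K) :=
  letI := U.prodLeft K
  letI := U.prodRight K
  { carrier := U.carrier × K
    comm := ⟨fun h g z => Prod.ext (smul_comm h.1 (MulOpposite.op g.unop.1) z.1)
      (mul_assoc h.2 z.2 g.unop.2).symm⟩ }

end FinBiset

/-! ### The Burnside functor with coefficients in a field -/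

/-- The relations `[X] = [Y]` for isomorphic `G`-sets and `[X ⊔ Y] = [X] + [Y]`. -/
def burnsideRel (F : Type v) [Field F] (G : Type u) [Group G] : Set (FinGSet G →₀ F) :=
  {a | ∃ X Y : FinGSet G, X.Iso Y ∧ a = Finsupp.single X 1 - Finsupp.single Y 1} ∪
  {a | ∃ X Y : FinGSet G,
    a = Finsupp.single (X.sum Y) 1 - (Finsupp.single X 1 + Finsupp.single Y 1)}

/-- `F ⊗ B(G)`, where `B(G)` is the Grothendieck group of finite `G`-sets, presented as an
`F`-vector space. -/
abbrev Burnside (F : Type v) [Field F] (G : Type u) [Group G] :=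
  (FinGSet G →₀ F) ⧸ Submodule.span F (burnsideRel F G)

namespace Burnside

/-- The class `[X]` of a finite `G`-set. -/
noncomputable def cls (F : Type v) [Field F] {G : Type u} [Group G] (X : FinGSet G) : Burnside F G :=
  Submodule.Quotient.mk (Finsupp.single X 1)

theorem cls_eq_of_iso (F : Type v) [Field F] {G : Type u} [Group G] {X Y : FinGSet G}
    (h : X.Iso Y) : cls F X = cls F Y :=
  (Submodule.Quotient.eq _).2 (Submodule.subset_span (Or.inl ⟨X, Y, h, rfl⟩))

theorem cls_sum (F : Type v) [Field F] {G : Type u} [Group G] (X Y : FinGSet G) :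
    cls F (X.sum Y) = cls F X + cls F Y :=
  (Submodule.Quotient.eq _).2 (Submodule.subset_span (Or.inr ⟨X, Y, rfl⟩))

/-- The linear map induced by an additive, isomorphism invariant function on finite `G`-sets. -/
noncomputable def lift {F : Type v} [Field F] {G : Type u} [Group G]
    {M : Type*} [AddCommGroup M] [Module F M] (f : FinGSet G → M)
    (hiso : ∀ X Y : FinGSet G, X.Iso Y → f X = f Y)
    (hsum : ∀ X Y : FinGSet G, f (X.sum Y) = f X + f Y) : Burnside F G →ₗ[F] M :=
  Submodule.liftQ _ (Finsupp.linearCombination F f) (by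
    rw [Submodule.span_le]
    rintro a (⟨X, Y, h, rfl⟩ | ⟨X, Y, rfl⟩)
    · simp [hiso X Y h]
    · simp [hsum X Y])

@[simp] theorem lift_cls {F : Type v} [Field F] {G : Type u} [Group G]
    {M : Type*} [AddCommGroup M] [Module F M] (f : FinGSet G → M)
    (hiso : ∀ X Y : FinGSet G, X.Iso Y → f X = f Y)
    (hsum : ∀ X Y : FinGSet G, f (X.sum Y) = f X + f Y) (X : FinGSet G) :
    lift (F := F) f hiso hsum (cls F X) = f X := by
  simp [lift, cls]

theorem hom_ext {F : Type v} [Field F] {G : Type u} [Group G]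
    {M : Type*} [AddCommGroup M] [Module F M] {f g : Burnside F G →ₗ[F] M}
    (h : ∀ X : FinGSet G, f (cls F X) = g (cls F X)) : f = g := by
  apply Submodule.linearMap_qext
  apply Finsupp.lhom_ext'
  intro X
  apply LinearMap.ext_ring
  exact h X

/-- Restriction `FB(B) → FB(A)` along a group homomorphism `A → B`. -/
noncomputable def res (F : Type v) [Field F] {A B : Type u} [Group A] [Group B] (f : A →* B) :
    Burnside F B →ₗ[F] Burnside F A :=
  lift (fun X => cls F (X.res f))
    (fun X Y ⟨e, he⟩ => cls_eq_of_iso F ⟨e, fun a x => he (f a) x⟩)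
    (fun X Y => by
      rw [← cls_sum]
      refine cls_eq_of_iso F ⟨Equiv.refl _, ?_⟩
      rintro a (x | x) <;> rfl)

/-- The map `FB(U) : FB(G) → FB(H)` sending `[X]` to `[U ×_G X]`, for an `(H, G)`-biset `U`. -/
noncomputable def map (F : Type v) [Field F] {H G : Type u} [Group H] [Group G]
    (U : FinBiset H G) : Burnside F G →ₗ[F] Burnside F H :=
  lift (fun X => cls F (U.tensor X))
    (fun X Y ⟨e, he⟩ => by
      refine cls_eq_of_iso F ⟨Quotient.congr (Equiv.prodCongr (Equiv.refl _) e) ?_, ?_⟩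
      · intro a b
        constructor
        · rintro ⟨g, rfl⟩
          exact ⟨g, Prod.ext rfl (he _ _)⟩
        · rintro ⟨g, h⟩
          refine ⟨g, Prod.ext (congrArg (fun z : U.carrier × Y.carrier => z.1) h) (e.injective ?_)⟩
          exact (congrArg (fun z : U.carrier × Y.carrier => z.2) h).trans (he _ _).symm
      · rintro h ⟨a⟩
        rfl)
    (fun X Y => by
      rw [← cls_sum]
      refine cls_eq_of_iso F ⟨
        { toFun := Quotient.lift (fun a : U.carrier × (X.carrier ⊕ Y.carrier) =>
            (match a with
            | (w, Sum.inl x) => Sum.inl (Quotient.mk (U.tensorSetoid X) (w, x))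
            | (w, Sum.inr y) => Sum.inr (Quotient.mk (U.tensorSetoid Y) (w, y)) :
              Quotient (U.tensorSetoid X) ⊕ Quotient (U.tensorSetoid Y))) ?_
          invFun := Sum.elim
            (Quotient.map (fun a => (a.1, Sum.inl a.2)) ?_)
            (Quotient.map (fun a => (a.1, Sum.inr a.2)) ?_)
          left_inv := ?_
          right_inv := ?_ }, ?_⟩
      · rintro ⟨w, x | x⟩ b ⟨g, rfl⟩
        · exact congrArg Sum.inl (Quotient.sound ⟨g, rfl⟩)
        · exact congrArg Sum.inr (Quotient.sound ⟨g, rfl⟩)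
      · rintro a b ⟨g, rfl⟩
        exact ⟨g, rfl⟩
      · rintro a b ⟨g, rfl⟩
        exact ⟨g, rfl⟩
      · rintro ⟨w, x | x⟩ <;> rfl
      · rintro (a | a)
        · induction a using Quotient.inductionOn
          rfl
        · induction a using Quotient.inductionOn
          rfl
      · rintro h ⟨w, x | x⟩ <;> rfl)

/-- The external product `FB(A) × FB(B) → FB(A × B)` induced by `(X, Y) ↦ X × Y`. -/
noncomputable def extProd (F : Type v) [Field F] (A B : Type u) [Group A] [Group B] :
    Burnside F A →ₗ[F] Burnside F B →ₗ[F] Burnside F (A × B) :=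
  lift
    (fun X => lift (fun Y => cls F (X.prod Y))
      (fun Y Z ⟨e, he⟩ => cls_eq_of_iso F ⟨Equiv.prodCongr (Equiv.refl _) e,
        fun g z => Prod.ext rfl (he g.2 z.2)⟩)
      (fun Y Z => by
        rw [← cls_sum]
        refine cls_eq_of_iso F ⟨Equiv.prodSumDistrib _ _ _, ?_⟩
        rintro g ⟨x, y | z⟩ <;> rfl))
    (fun X Y ⟨e, he⟩ => hom_ext fun Z => by
      rw [lift_cls, lift_cls]
      exact cls_eq_of_iso F ⟨Equiv.prodCongr e (Equiv.refl _),
        fun g z => Prod.ext (he g.1 z.1) rfl⟩)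
    (fun X Y => hom_ext fun Z => by
      rw [LinearMap.add_apply, lift_cls, lift_cls, lift_cls, ← cls_sum]
      refine cls_eq_of_iso F ⟨Equiv.sumProdDistrib _ _ _, ?_⟩
      rintro g ⟨x | y, z⟩ <;> rfl)

/-- The Möbius function of the poset of subgroups of a finite group. -/
noncomputable def subgroupMu {G : Type u} [Group G] [Finite G] (X Y : Subgroup G) : ℤ := by
  classical
  letI : Fintype (Subgroup G) := Fintype.ofFinite _
  letI : LocallyFiniteOrder (Subgroup G) := Fintype.toLocallyFiniteOrder
  exact IncidenceAlgebra.mu ℤ X Y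

/-- The primitive idempotent `e_L^G` of `FB(G)`, given by the Gluck-Yoshida formula
`|N_G(L)|⁻¹ ∑_{X ≤ L} |X| μ(X, L) [G / X]`. -/
noncomputable def idem (F : Type v) [Field F] {G : Type u} [Group G] [Finite G]
    (L : Subgroup G) : Burnside F G :=
  (Nat.card (Subgroup.normalizer (L : Set G)) : F)⁻¹ •
    ∑ᶠ (X : Subgroup G) (_ : X ≤ L),
      ((Nat.card X : F) * (subgroupMu X L : F)) • cls F (FinGSet.coset X)

end Burnside

open Burnside

/-! ### The shifted Burnside functor `FB_K` and its ideals -/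

/-- The evaluation `FB_K(G) = FB(G × K)`. -/
abbrev Shifted (F : Type v) [Field F] (K G : Type u) [Group K] [Group G] :=
  Burnside F (G × K)

/-- The map `FB_K(U) = FB(U × K) : FB_K(G) → FB_K(H)`, for an `(H, G)`-biset `U`. -/
noncomputable def Shifted.map (F : Type v) [Field F] (K : Type u) [Group K] [Finite K]
    {H G : Type u} [Group H] [Group G] (U : FinBiset H G) :
    Shifted F K G →ₗ[F] Shifted F K H :=
  Burnside.map F (U.prodGroup K)

/-- The injective homomorphism `((g, h), k) ↦ ((g, k), (h, k))`, with image `Δ`. -/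
def diagHom (K G H : Type u) [Group K] [Group G] [Group H] :
    (G × H) × K →* (G × K) × (H × K) where
  toFun x := ((x.1.1, x.2), (x.1.2, x.2))
  map_one' := rfl
  map_mul' _ _ := rfl

/-- The product `FB_K(G) × FB_K(H) → FB_K(G × H)` of the Green biset functor `FB_K`: the external
product in `FB((G × K) × (H × K))` followed by restriction to `Δ ≅ (G × H) × K`. -/
noncomputable def Shifted.prod (F : Type v) [Field F] (K G H : Type u)
    [Group K] [Group G] [Group H] (a : Shifted F K G) (b : Shifted F K H) :
    Shifted F K (G × H) :=
  res F (diagHom K G H) (extProd F (G × K) (H × K) a b)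

/-- An ideal of the Green biset functor `FB_K`: an `FB_K`-submodule of `FB_K`, that is, a
subspace `I(G)` of `FB_K(G)` for each finite group `G`, stable under all finite bisets (hence
under all their linear combinations) and under left multiplication by elements of `FB_K`. -/
structure ShiftedIdeal (F : Type v) [Field F] (K : Type u) [Group K] [Finite K] where
  obj : ∀ (G : Type u) [Group G] [Finite G], Submodule F (Shifted F K G)
  map_mem : ∀ {G H : Type u} [Group G] [Finite G] [Group H] [Finite H] (U : FinBiset H G)
    {a : Shifted F K G}, a ∈ obj G → Shifted.map F K U a ∈ obj H
  prod_mem : ∀ {G H : Type u} [Group G] [Finite G] [Group H] [Finite H] (a : Shifted F K G)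
    {b : Shifted F K H}, b ∈ obj H → Shifted.prod F K G H a b ∈ obj (G × H)

/-- The ideal of `FB_K` generated by an element `a ∈ FB_K(L)`: the intersection of all ideals `I`
with `a ∈ I(L)`. -/
noncomputable def ShiftedIdeal.generated (F : Type v) [Field F] (K : Type u) [Group K] [Finite K]
    {L : Type u} [Group L] [Finite L] (a : Shifted F K L) : ShiftedIdeal F K where
  obj G _ _ := sInf {V | ∃ I : ShiftedIdeal F K, a ∈ I.obj L ∧ V = I.obj G}
  map_mem := by
    intro G H _ _ _ _ U x hx
    rw [Submodule.mem_sInf] at hx ⊢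
    rintro V ⟨I, hI, rfl⟩
    exact I.map_mem U (hx _ ⟨I, hI, rfl⟩)
  prod_mem := by
    intro G H _ _ _ _ x y hy
    rw [Submodule.mem_sInf] at hy ⊢
    rintro V ⟨I, hI, rfl⟩
    exact I.prod_mem x (hy _ ⟨I, hI, rfl⟩)

/-! ### Groups over `K` -/

/-- The ideal `e_{L,φ}` of `FB_K`, generated by `e_{L_φ}^{L × K}`, where `L_φ` is the graph
of `φ`. -/
noncomputable def eIdeal (F : Type v) [Field F] {K L : Type u} [Group K] [Finite K]
    [Group L] [Finite L] (φ : L →* K) : ShiftedIdeal F K :=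
  ShiftedIdeal.generated F K (idem F φ.graph)

/-- The group `(L, φ)` over `K` is `p`-persistent: `e_{L,φ}(P) ≠ 0` for some finite
`p`-group `P`. -/
def IsPersistent (F : Type v) [Field F] (p : ℕ) {K L : Type u} [Group K] [Finite K]
    [Group L] [Finite L] (φ : L →* K) : Prop :=
  ∃ (P : Type u) (_ : Group P) (_ : Finite P), IsPGroup p P ∧ (eIdeal F φ).obj P ≠ ⊥

open scoped Pointwise in
/-- `m_{L,N} = |L|⁻¹ ∑_{X ≤ L, XN = L} |X| μ(X, L)`. -/
noncomputable def mConst (L : Type u) [Group L] [Finite L] (N : Subgroup L) : ℚ :=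
  (Nat.card L : ℚ)⁻¹ *
    ∑ᶠ (X : Subgroup L) (_ : (X : Set L) * (N : Set L) = Set.univ),
      (Nat.card X : ℚ) * (subgroupMu X ⊤ : ℚ)

/-- `(L, φ)` is a `B_K`-group: `m_{L,N} = 0` for every nontrivial normal subgroup `N` of `L`
contained in the kernel of `φ`. -/
def IsBGroup {K L : Type u} [Group K] [Group L] [Finite L] (φ : L →* K) : Prop :=
  ∀ N : Subgroup L, N.Normal → N ≤ φ.ker → N ≠ ⊥ → mConst L N = 0

/-- `O^p(L)`: the subgroup generated by the elements of order prime to `p`. -/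
def Op (p : ℕ) (L : Type u) [Group L] : Subgroup L :=
  Subgroup.closure {x | (orderOf x).Coprime p}

instance Op.normal (p : ℕ) (L : Type u) [Group L] : (Op p L).Normal := by
  refine ⟨fun n hn g => ?_⟩
  have h : Op p L ≤ (Op p L).comap (MulAut.conj g).toMonoidHom := by
    refine (Subgroup.closure_le _).2 fun x hx => Subgroup.subset_closure ?_
    have : orderOf (MulAut.conj g x) = orderOf x := MulEquiv.orderOf_eq _ x
    change (orderOf (MulAut.conj g x)).Coprime p
    rw [this]
    exact hx
  simpa using h hn

end RelBGroup

/-! The substance is (i) ⇒ (iii): if `m_{L,N} = 0` for `N = O^p(L) ∩ ker φ`, then `e_{L,φ}` vanishes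
on all `p`-groups. To see this, `e_{L_φ}^{L × K}` is placed in an ideal, `fixIdeal`, that is zero at
every finite `p`-group. This ideal is cut out by the forms sending `[Y]` to `|Γ|` times the number
of `T`-fixed points of `Γ \ (V × Y)`, where `Γ` acts on `Y` through `G` and `T` through `K`. Since
`Γ` and `V` are arbitrary, a biset or a factor can be absorbed into them
(`card_smul_twistCount_map`, `twistCount_prod_cls`) while `(T, κ)` stays fixed. So the only
condition imposed, `O^p(T) ∩ ker κ = 1`, survives. At a `p`-group `P`, every subgroup `T` of `P × K`
satisfies it, and with `Γ = V = P` the forms become the marks; by Burnside's theorem the ideal is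
zero there.

For membership, Burnside's orbit lemma turns the form on the idempotent into a sum over points `z`
of sums over `X ≤ L` weighted by `μ(X, L)` (`sum_moebius_mul_fixCount_eq_zero`). Unless the
stabilizer of `z` maps onto `L`, a Weisner type identity kills the sum. If it does, the sum is zero
or a multiple of `∑_{XS = L} |X| μ(X, L)`, with `S` the image in `L` of the stabilizer of `z` in `Γ
× L`. The condition on `T` forces `N ≤ S` (`Op_inf_ker_le_stabImage`), and then `m_{L,N} = 0` makes
the sum vanish.

For (iii) ⇒ (ii), the deflation of the idempotent to `L / O^p(L)` has a mark that is a nonzero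
multiple of `m_{L,N}`. As `L / O^p(L)` is a `p`-group, (ii) ⇒ (i) is immediate. -/

namespace RelBGroup

open Burnside

/-! ### Möbius inversion in the subgroup lattice -/

section Poset

open scoped Classical in
-- Induction downwards from the maximal elements. With `sum_le_sum_fiber` it reduces the vanishing
-- of sums over fibres to that of cumulative sums, which are easier to evaluate.
theorem eq_zero_of_sum_ge_eq_zero {α M : Type*} [PartialOrder α] [Fintype α] [AddCommGroup M]
    (h : α → M) (H : ∀ a, ∑ b with a ≤ b, h b = 0) (a : α) : h a = 0 := by
  induction a using (wellFounded_gt (α := α)).induction with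
  | _ a ih =>
    have h1 := H a
    rwa [Finset.sum_eq_single_of_mem a (by simp) fun b hb hba =>
      ih b (lt_of_le_of_ne (Finset.mem_filter.1 hb).2 (Ne.symm hba))] at h1

open scoped Classical in
theorem sum_subgroupMu {G : Type u} [Group G] [Finite G] [Fintype (Subgroup G)]
    (Y X : Subgroup G) :
    ∑ Z with Y ≤ Z ∧ Z ≤ X, subgroupMu Z X = if Y = X then 1 else 0 := by
  let _ : LocallyFiniteOrder (Subgroup G) :=
    @Fintype.toLocallyFiniteOrder _ _ (Fintype.ofFinite _) _ _
  have h := IncidenceAlgebra.sum_Icc_mu_left (𝕜 := ℤ) Y X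
  rw [show ({Z | Y ≤ Z ∧ Z ≤ X} : Finset (Subgroup G)) = Finset.Icc Y X by ext; simp]
  exact h

open scoped Classical in
theorem sum_le_sum_fiber {α ι M : Type*} [PartialOrder α] [Fintype α] [Fintype ι]
    [AddCommMonoid M] (g : ι → α) (f : ι → M) (a : α) :
    ∑ b with a ≤ b, ∑ i with g i = b, f i = ∑ i with a ≤ g i, f i := by
  rw [← Finset.sum_fiberwise_of_maps_to (s := Finset.univ.filter fun i => a ≤ g i) (g := g)
    (t := Finset.univ.filter fun b => a ≤ b) (by simp)]
  refine Finset.sum_congr rfl fun b hb => Finset.sum_congr ?_ fun _ _ => rfl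
  ext i
  simp only [Finset.mem_filter, Finset.mem_univ, true_and] at hb ⊢
  exact ⟨fun h => ⟨h ▸ hb, h⟩, fun h => h.2⟩

end Poset

/-- The values `μ(X, L)` of the Möbius function, characterized by the relation
`∑_{Y ≤ X} μ(X, L) = δ_{Y, L}`. -/
def IsMoebius {L : Type u} [Group L] [Fintype (Subgroup L)] (ν : Subgroup L → ℚ) : Prop :=
  open scoped Classical in ∀ Y, ∑ X with Y ≤ X, ν X = if Y = ⊤ then 1 else 0

namespace IsMoebius

variable {L : Type u} [Group L] [Fintype (Subgroup L)] {ν : Subgroup L → ℚ}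

theorem unique {ν' : Subgroup L → ℚ} (h : IsMoebius ν) (h' : IsMoebius ν') : ν = ν' := by
  ext X
  refine sub_eq_zero.1 (eq_zero_of_sum_ge_eq_zero (fun X => ν X - ν' X) (fun Y => ?_) X)
  rw [Finset.sum_sub_distrib, h Y, h' Y, sub_self]

theorem top [Finite L] : IsMoebius fun X : Subgroup L => (subgroupMu X ⊤ : ℚ) := by
  classical
  intro Y
  have h := sum_subgroupMu Y ⊤
  simp only [le_top, and_true] at h
  have h' := congrArg (Int.cast : ℤ → ℚ) h
  push_cast at h'
  exact h'

open scoped Classical in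
-- Weisner's identity: summed over all `Z' ≥ Z`, the left side is zero if `Z ≰ R`, and otherwise the
-- defining sum of `ν` at `Z`, which vanishes because `Z ≤ R < L`.
theorem sum_inf_eq (h : IsMoebius ν) {R : Subgroup L} (hR : R ≠ ⊤) (Z : Subgroup L) :
    ∑ X with X ⊓ R = Z, ν X = 0 := by
  refine eq_zero_of_sum_ge_eq_zero (fun Z => ∑ X with X ⊓ R = Z, ν X) (fun Z => ?_) Z
  rw [sum_le_sum_fiber]
  by_cases hZ : Z ≤ R
  · simp only [le_inf_iff, hZ, and_true]
    rw [h Z, if_neg]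
    rintro rfl
    exact hR (top_le_iff.1 hZ)
  · simp [hZ]

theorem sum_mul_inf (h : IsMoebius ν) {R : Subgroup L} (hR : R ≠ ⊤) (f : Subgroup L → ℚ) :
    ∑ X, ν X * f (X ⊓ R) = 0 := by
  classical
  rw [← Finset.sum_fiberwise Finset.univ (fun X => X ⊓ R)]
  refine Finset.sum_eq_zero fun Z _ => ?_
  rw [Finset.sum_congr rfl (g := fun X => ν X * f Z) fun X hX => by
    rw [(Finset.mem_filter.1 hX).2], ← Finset.sum_mul, h.sum_inf_eq hR, zero_mul]

end IsMoebius

open scoped Pointwise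

/-! ### Orders and indices when a product of subgroups is the whole group. -/

/-- `XS = L` makes `S` transitive on `L / X`, with point stabilizer `X ∩ S`. Here `S` need not be
normal. -/
theorem relIndex_eq_index_of_mul_eq_univ {L : Type u} [Group L] {X S : Subgroup L}
    (h : (X : Set L) * (S : Set L) = Set.univ) : X.relIndex S = X.index := by
  have key (l : L) : ∃ s : S, s • ((1 : L) : L ⧸ X) = (l : L ⧸ X) := by
    obtain ⟨x, hx, s, hs, e⟩ := Set.mem_mul.1 (h ▸ Set.mem_univ l⁻¹)
    refine ⟨⟨s, hs⟩⁻¹, ?_⟩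
    change (((s⁻¹ * 1 : L)) : L ⧸ X) = l
    rw [QuotientGroup.eq, ← inv_inv l, ← e]
    simpa using hx
  have : MulAction.IsPretransitive S (L ⧸ X) := MulAction.isPretransitive_iff_base ((1 : L) : L ⧸ X)
    |>.2 fun q => by
      induction q using QuotientGroup.induction_on
      exact key _
  have h1 := MulAction.index_stabilizer_of_transitive S ((1 : L) : L ⧸ X)
  rw [Subgroup.relIndex, Subgroup.index_eq_card X, ← h1]
  congr 1
  ext s
  rw [Subgroup.mem_subgroupOf, MulAction.mem_stabilizer_iff]
  change _ ↔ ((((s : L) * 1 : L)) : L ⧸ X) = (1 : L)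
  rw [eq_comm, QuotientGroup.eq]
  simp

theorem card_comap_mul_card {A L : Type u} [Group A] [Group L] [Finite A] [Finite L]
    (f : A →* L) (X : Subgroup L)
    (h : (X : Set L) * (f.range : Set L) = Set.univ) :
    Nat.card (X.comap f) * Nat.card L = Nat.card A * Nat.card X := by
  have h1 := X.index_comap f
  rw [relIndex_eq_index_of_mul_eq_univ h] at h1
  rw [← X.card_mul_index, ← (X.comap f).card_mul_index, h1]
  ring

theorem card_sup_mul_card_inf {L : Type u} [Group L] [Finite L] (X N : Subgroup L) [N.Normal] :
    Nat.card ↥(X ⊔ N) * Nat.card ↥(X ⊓ N) = Nat.card X * Nat.card N := by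
  have h1 : N.relIndex (X ⊔ N) = N.relIndex X := Subgroup.relIndex_sup_right X N
  have h2 := Subgroup.relIndex_mul_relIndex ⊥ N (X ⊔ N) bot_le le_sup_right
  have h3 := Subgroup.relIndex_mul_relIndex ⊥ (X ⊓ N) X bot_le inf_le_left
  rw [Subgroup.inf_relIndex_left] at h3
  simp only [Subgroup.relIndex_bot_left] at h2 h3
  rw [← h2, ← h3, h1]
  ring

theorem mul_eq_univ_iff_sup_eq_top {L : Type u} [Group L] (X N : Subgroup L) [N.Normal] :
    (X : Set L) * (N : Set L) = Set.univ ↔ X ⊔ N = ⊤ := by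
  rw [← X.mul_normal N, ← Subgroup.coe_top, SetLike.coe_set_eq]

/-! ### Consequences of `m_{L,N} = 0`. -/

section Deflation

variable {L : Type u} [Group L] [Finite L] [Fintype (Subgroup L)] {ν : Subgroup L → ℚ}

open scoped Classical in
/-- Vanishing of `m_{L,N}` forces the whole deflation of the idempotent `e_L^L` by `N` to
vanish. -/
theorem IsMoebius.sum_sup_eq_zero (h : IsMoebius ν) (N : Subgroup L) [N.Normal]
    (hN : ∑ X with X ⊔ N = ⊤, (Nat.card X : ℚ) * ν X = 0) (Y : Subgroup L) :
    ∑ X with X ⊔ N = Y, (Nat.card X : ℚ) * ν X = 0 := by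
  have hcard (X : Subgroup L) : (Nat.card X : ℚ) =
      Nat.card ↥(X ⊔ N) / Nat.card N * Nat.card ↥(X ⊓ N) := by
    have h1 := congrArg (Nat.cast : ℕ → ℚ) (card_sup_mul_card_inf X N)
    push_cast at h1
    have : (Nat.card N : ℚ) ≠ 0 := by exact_mod_cast Nat.card_pos.ne'
    field_simp
    linarith
  have hmain (Y : Subgroup L) : ∑ X with X ⊔ N = Y, (Nat.card ↥(X ⊓ N) : ℚ) * ν X = 0 := by
    refine eq_zero_of_sum_ge_eq_zero
      (fun Y => ∑ X with X ⊔ N = Y, (Nat.card ↥(X ⊓ N) : ℚ) * ν X) (fun R => ?_) Y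
    rw [sum_le_sum_fiber]
    by_cases hR : R ⊔ N = ⊤
    -- When `RN = L`, the condition `R ≤ XN` means `XN = L`, and `|X ∩ N|` is then `|X|` times the
    -- constant `|N| / |L|`.
    · rw [Finset.sum_congr (s₂ := {X | X ⊔ N = ⊤})
        (g := fun X => (Nat.card N / Nat.card L : ℚ) * (Nat.card X * ν X)) ?_ ?_,
        ← Finset.mul_sum, hN, mul_zero]
      · ext X
        simp only [Finset.mem_filter, Finset.mem_univ, true_and]
        refine ⟨fun hX => top_le_iff.1 (hR ▸ sup_le hX le_sup_right), fun hX => hX ▸ le_top⟩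
      · intro X hX
        rw [hcard X, (Finset.mem_filter.1 hX).2, Subgroup.card_top]
        have : (Nat.card N : ℚ) ≠ 0 := by exact_mod_cast Nat.card_pos.ne'
        have : (Nat.card L : ℚ) ≠ 0 := by exact_mod_cast Nat.card_pos.ne'
        field_simp
    -- When `RN ≠ L`, the summand depends on `X` only through `X ∩ RN`; `e2` is the modular law.
    · rw [← h.sum_mul_inf hR fun Z => if R ≤ Z ⊔ N then (Nat.card ↥(Z ⊓ N) : ℚ) else 0,
        Finset.sum_filter]
      refine Finset.sum_congr rfl fun X _ => ?_
      have e1 : X ⊓ (R ⊔ N) ⊓ N = X ⊓ N := by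
        rw [inf_assoc, inf_eq_right.2 (le_sup_right : N ≤ R ⊔ N)]
      have e2 : R ≤ X ⊓ (R ⊔ N) ⊔ N ↔ R ≤ X ⊔ N := by
        refine ⟨fun hh => hh.trans (sup_le_sup_right inf_le_left _), fun hh r hr => ?_⟩
        obtain ⟨x, hx, n, hn, rfl⟩ := Set.mem_mul.1 ((X.mul_normal N).subset (hh hr))
        refine mul_mem (Subgroup.mem_sup_left ⟨hx, ?_⟩) (Subgroup.mem_sup_right hn)
        have := mul_mem (Subgroup.mem_sup_left (T := N) hr)
          (Subgroup.mem_sup_right (S := R) (inv_mem hn))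
        simpa using this
      rw [e1]
      simp only [e2]
      split_ifs <;> ring
  rw [Finset.sum_congr rfl (g := fun X =>
    (Nat.card Y / Nat.card N : ℚ) * (Nat.card ↥(X ⊓ N) * ν X)) ?_, ← Finset.mul_sum, hmain, mul_zero]
  intro X hX
  rw [hcard X, (Finset.mem_filter.1 hX).2, mul_assoc]

open scoped Classical in
theorem mConst_eq_zero_iff (N : Subgroup L) [N.Normal] :
    mConst L N = 0 ↔
      ∑ X : Subgroup L with X ⊔ N = ⊤, (Nat.card X : ℚ) * (subgroupMu X ⊤ : ℚ) = 0 := by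
  have : (Nat.card L : ℚ) ≠ 0 := by exact_mod_cast Nat.card_pos.ne'
  rw [mConst, mul_eq_zero, or_iff_right (inv_ne_zero this),
    Finset.sum_filter, finsum_eq_sum_of_fintype]
  simp_rw [finsum_eq_if, mul_eq_univ_iff_sup_eq_top]

open scoped Classical in
-- As `N ≤ S`, the set `XS` depends only on `XN`, so the sum splits into full fibres of `X ↦ XN`,
-- each of which vanishes.
theorem IsMoebius.sum_mul_eq_univ_eq_zero (h : IsMoebius ν) (N S : Subgroup L) [N.Normal]
    (hNS : N ≤ S) (hN : ∑ X with X ⊔ N = ⊤, (Nat.card X : ℚ) * ν X = 0) :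
    ∑ X ∈ Finset.univ.filter fun X : Subgroup L => (X : Set L) * (S : Set L) = Set.univ,
      (Nat.card X : ℚ) * ν X = 0 := by
  have e (X : Subgroup L) : (↑(X ⊔ N) : Set L) * (S : Set L) = (X : Set L) * (S : Set L) := by
    rw [X.mul_normal N, mul_assoc]
    congr 1
    refine Set.Subset.antisymm ?_ (Set.subset_mul_right _ N.one_mem)
    rintro _ ⟨n, hn, s, hs, rfl⟩
    exact mul_mem (hNS hn) hs
  rw [Finset.sum_filter, ← Finset.sum_fiberwise Finset.univ (fun X => X ⊔ N)]
  refine Finset.sum_eq_zero fun Y _ => ?_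
  by_cases hY : (Y : Set L) * (S : Set L) = Set.univ
  · rw [← h.sum_sup_eq_zero N hN Y]
    refine Finset.sum_congr rfl fun X hX => if_pos ?_
    rw [← e, (Finset.mem_filter.1 hX).2, hY]
  · refine Finset.sum_eq_zero fun X hX => if_neg ?_
    rwa [← e, (Finset.mem_filter.1 hX).2]

end Deflation

/-! ### Marks and Burnside's theorem -/

namespace Burnside

variable (F : Type v) [Field F] {G : Type u} [Group G]

theorem cls_eq_zero_of_isEmpty (X : FinGSet G) [IsEmpty X.carrier] : cls F X = 0 := by
  have : IsEmpty (X.sum X).carrier := inferInstanceAs (IsEmpty (X.carrier ⊕ X.carrier))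
  have h := cls_eq_of_iso F (X := X.sum X) (Y := X) ⟨Equiv.equivOfIsEmpty _ _, fun _ x => isEmptyElim x⟩
  rwa [cls_sum, add_eq_left] at h

theorem cls_eq_coset_of_isPretransitive [Finite G] (X : FinGSet G)
    [MulAction.IsPretransitive G X.carrier] (x : X.carrier) :
    cls F X = cls F (FinGSet.coset (MulAction.stabilizer G x)) := by
  refine (cls_eq_of_iso F (X := FinGSet.coset (MulAction.stabilizer G x))
    ⟨Equiv.ofBijective (MulAction.ofQuotientStabilizer G x)
    ⟨MulAction.injective_ofQuotientStabilizer G x, fun y => ?_⟩,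
    fun g q => MulAction.ofQuotientStabilizer_smul G x g q⟩).symm
  obtain ⟨g, rfl⟩ := MulAction.exists_smul_eq G x y
  exact ⟨(g : G ⧸ _), rfl⟩

/-- The complement of an orbit of a finite `G`-set. -/
def _root_.RelBGroup.FinGSet.orbitCompl (X : FinGSet G) (x : X.carrier) : FinGSet G where
  carrier := {y : X.carrier // y ∉ MulAction.orbit G x}
  action :=
    { smul := fun g y => ⟨g • y.1, fun ⟨h, e⟩ => y.2 ⟨g⁻¹ * h, by
        change (g⁻¹ * h) • x = y.1
        rw [mul_smul, show h • x = g • y.1 from e, inv_smul_smul]⟩⟩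
      one_smul := fun y => Subtype.ext (one_smul G y.1)
      mul_smul := fun g h y => Subtype.ext (mul_smul g h y.1) }

variable {F}

theorem cls_eq_coset_add_orbitCompl [Finite G] (X : FinGSet G) (x : X.carrier) :
    cls F X = cls F (FinGSet.coset (MulAction.stabilizer G x)) + cls F (X.orbitCompl x) := by
  rw [← cls_sum]
  have hmem (q : G ⧸ MulAction.stabilizer G x) :
      MulAction.ofQuotientStabilizer G x q ∈ MulAction.orbit G x := by
    induction q using QuotientGroup.induction_on
    exact ⟨_, rfl⟩
  refine (cls_eq_of_iso F ⟨Equiv.ofBijective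
    (Sum.elim (MulAction.ofQuotientStabilizer G x) Subtype.val) ⟨?_, fun y => ?_⟩, ?_⟩).symm
  · rintro (a | a) (b | b) h
    · exact congrArg _ (MulAction.injective_ofQuotientStabilizer G x h)
    · exact absurd (Eq.subst (motive := (· ∈ MulAction.orbit G x)) h (hmem a)) b.2
    · exact absurd (Eq.subst (motive := (· ∈ MulAction.orbit G x)) h.symm (hmem b)) a.2
    · exact congrArg _ (Subtype.ext h)
  · by_cases hy : y ∈ MulAction.orbit G x
    · obtain ⟨g, rfl⟩ := hy
      exact ⟨Sum.inl (g : G ⧸ _), rfl⟩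
    · exact ⟨Sum.inr ⟨y, hy⟩, rfl⟩
  · rintro g (q | y)
    · exact MulAction.ofQuotientStabilizer_smul G x g q
    · rfl

/-- Orbits are removed one at a time, by induction on the number of points. -/
theorem hom_ext_coset [Finite G] {M : Type*} [AddCommGroup M] [Module F M]
    {f g : Burnside F G →ₗ[F] M}
    (h : ∀ X : Subgroup G, f (cls F (FinGSet.coset X)) = g (cls F (FinGSet.coset X))) : f = g := by
  refine hom_ext fun X => ?_
  induction hn : Nat.card X.carrier using Nat.strong_induction_on generalizing X with
  | _ n ih =>
    rcases isEmpty_or_nonempty X.carrier with hX | ⟨⟨x⟩⟩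
    · rw [cls_eq_zero_of_isEmpty, map_zero, map_zero]
    · rw [cls_eq_coset_add_orbitCompl X x, map_add, map_add, h, ih _ _ _ rfl]
      rw [← hn]
      exact Finite.card_subtype_lt (x := x) (not_not.2 (MulAction.mem_orbit_self x))

variable (F) in
/-- The linear form counting the points of a `G`-set whose stabilizer satisfies `Q`. -/
noncomputable def stabCount (Q : Subgroup G → Prop) : Burnside F G →ₗ[F] F :=
  lift (fun X => (Nat.card {x : X.carrier // Q (MulAction.stabilizer G x)} : F))
    (fun X Y ⟨e, he⟩ => by
      congr 1
      refine Nat.card_congr (e.subtypeEquiv fun x => ?_)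
      suffices MulAction.stabilizer G x = MulAction.stabilizer G (e x) by rw [this]
      ext g
      rw [MulAction.mem_stabilizer_iff, MulAction.mem_stabilizer_iff, ← he, e.apply_eq_iff_eq])
    (fun X Y => by
      rw [← Nat.cast_add, ← Nat.card_sum]
      congr 1
      refine Nat.card_congr ((Equiv.subtypeSum (α := X.carrier) (β := Y.carrier)).trans
        (Equiv.sumCongr (Equiv.subtypeEquivRight fun x => ?_)
          (Equiv.subtypeEquivRight fun y => ?_)))
      · suffices MulAction.stabilizer G (Sum.inl x : X.carrier ⊕ Y.carrier) =
          MulAction.stabilizer G x by rw [← this]; rfl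
        ext g
        simp [MulAction.mem_stabilizer_iff]
      · suffices MulAction.stabilizer G (Sum.inr y : X.carrier ⊕ Y.carrier) =
          MulAction.stabilizer G y by rw [← this]; rfl
        ext g
        simp [MulAction.mem_stabilizer_iff])

theorem stabCount_cls (Q : Subgroup G → Prop) (X : FinGSet G) :
    stabCount F Q (cls F X) = Nat.card {x : X.carrier // Q (MulAction.stabilizer G x)} :=
  lift_cls _ _ _ X

open scoped Classical in
theorem sum_stabCount_eq [Fintype (Subgroup G)] (Q : Subgroup G → Prop) (a : Burnside F G) :
    ∑ Y with Q Y, stabCount F (· = Y) a = stabCount F Q a := by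
  rw [← LinearMap.sum_apply]
  congr 1
  refine hom_ext fun X => ?_
  rw [LinearMap.sum_apply]
  simp only [stabCount_cls]
  have := Fintype.ofFinite X.carrier
  simp only [Nat.card_eq_fintype_card, Fintype.card_subtype]
  rw [← Nat.cast_sum, Finset.card_eq_sum_card_fiberwise (f := fun x => MulAction.stabilizer G x)
    (t := Finset.univ.filter Q) (by intro; simp)]
  congr 1
  refine Finset.sum_congr rfl fun Y hY => ?_
  congr 1
  ext x
  simp only [Finset.mem_filter, Finset.mem_univ, true_and] at hY ⊢
  exact ⟨fun h => ⟨h ▸ hY, h⟩, fun h => h.2⟩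

theorem card_stabilizer_coset [Finite G] (X : Subgroup G) (x : G ⧸ X) :
    Nat.card (MulAction.stabilizer G x) = Nat.card X := by
  have h1 := (MulAction.stabilizer G x).card_mul_index
  rw [MulAction.index_stabilizer_of_transitive, ← Subgroup.index_eq_card,
    ← X.card_mul_index] at h1
  exact Nat.eq_of_mul_eq_mul_right (Nat.pos_of_ne_zero X.index_ne_zero_of_finite) h1

/-- Each orbit `G / X` has `|G : X|` points, each weighted by `|X|`, so it is counted `|G|` times on
the right. -/
theorem card_smul_eq_sum_stabCount [Finite G] [Fintype (Subgroup G)] (a : Burnside F G) :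
    (Nat.card G : F) • a =
      ∑ Y : Subgroup G, ((Nat.card Y : F) * stabCount F (· = Y) a) • cls F (FinGSet.coset Y) := by
  classical
  suffices (Nat.card G : F) • (LinearMap.id : Burnside F G →ₗ[F] _) =
      ∑ Y : Subgroup G, (Nat.card Y : F) •
        (stabCount F (· = Y)).smulRight (cls F (FinGSet.coset Y)) by
    have h := LinearMap.congr_fun this a
    simpa [LinearMap.sum_apply, mul_smul] using h
  refine hom_ext_coset fun X => ?_
  have := Fintype.ofFinite (G ⧸ X)
  have hst (x : G ⧸ X) : Nat.card (MulAction.stabilizer G x) = Nat.card X ∧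
      cls F (FinGSet.coset (MulAction.stabilizer G x)) = cls F (FinGSet.coset X) := by
    refine ⟨card_stabilizer_coset X x, ?_⟩
    have : MulAction.IsPretransitive G (FinGSet.coset X).carrier :=
      inferInstanceAs (MulAction.IsPretransitive G (G ⧸ X))
    exact (cls_eq_coset_of_isPretransitive F (FinGSet.coset X) x).symm
  simp only [LinearMap.sum_apply, LinearMap.smul_apply, LinearMap.smulRight_apply,
    LinearMap.id_apply, stabCount_cls]
  have hc (Y : Subgroup G) : (Nat.card {x : G ⧸ X // MulAction.stabilizer G x = Y} : F) =
      ∑ x : G ⧸ X, if MulAction.stabilizer G x = Y then 1 else 0 := by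
    rw [Nat.card_eq_fintype_card, Fintype.card_subtype, Finset.sum_boole]
  change _ = ∑ Y : Subgroup G, (Nat.card Y : F) •
    (Nat.card {x : G ⧸ X // MulAction.stabilizer G x = Y} : F) • cls F (FinGSet.coset Y)
  simp only [hc, Finset.sum_smul, Finset.smul_sum]
  rw [Finset.sum_comm, Finset.sum_congr rfl (g := fun _ => (Nat.card X : F) •
    cls F (FinGSet.coset X))]
  · rw [Finset.sum_const, Finset.card_univ, ← Nat.card_eq_fintype_card, ← Subgroup.index_eq_card,
      ← X.card_mul_index, mul_comm, Nat.cast_mul, mul_smul, Nat.cast_smul_eq_nsmul]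
  · intro x _
    rw [Finset.sum_eq_single (MulAction.stabilizer G x) (fun Y _ hY => by simp [Ne.symm hY])
      (by simp), if_pos rfl, one_smul, (hst x).1, (hst x).2]

/-- Burnside's theorem: `stabCount F (Y ≤ ·)` is the mark at `Y`. Inverting over `Y` gives the
numbers of points with exact stabilizer `Y`, which determine `a`. -/
theorem eq_zero_of_stabCount_le_eq_zero [CharZero F] [Finite G] (a : Burnside F G)
    (h : ∀ Y, stabCount F (Y ≤ ·) a = 0) : a = 0 := by
  classical
  have := Fintype.ofFinite (Subgroup G)
  have h0 := eq_zero_of_sum_ge_eq_zero (fun Y => stabCount F (· = Y) a) fun Y =>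
    (sum_stabCount_eq (fun Z => Y ≤ Z) a).trans (h Y)
  have h1 := card_smul_eq_sum_stabCount a
  simp only [h0, mul_zero, zero_smul, Finset.sum_const_zero] at h1
  exact (smul_eq_zero.1 h1).resolve_left (by exact_mod_cast Nat.card_pos.ne')

end Burnside

/-! ### Counting the orbits of one group which are fixed by a commuting group -/

section FixCount

variable (F : Type v) [Field F]

/-- The linear form on `FB(Γ × T)` whose value at `Z` is `|Γ|` times the number of `T`-fixed points
of `Γ \ Z`. -/
noncomputable def fixCount (Γ T : Type u) [Group Γ] [Group T] [Finite Γ] :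
    Burnside F (Γ × T) →ₗ[F] F :=
  letI := Fintype.ofFinite Γ
  ∑ c : Γ, stabCount F fun S : Subgroup (Γ × T) => (c, 1) ∈ S ∧ ∀ t, ∃ c' : Γ, (c', t) ∈ S

variable {Γ T : Type u} [Group Γ] [Group T]

/-- The points of a `Γ × T`-set whose `Γ`-orbit is fixed by `T`. -/
def StablePoint (Z : FinGSet (Γ × T)) : Type u :=
  {z : Z.carrier // ∀ t, ∃ c : Γ, ((c, t) : Γ × T) • z = z}

instance (Z : FinGSet (Γ × T)) : MulAction Γ (StablePoint Z) where
  smul c z := ⟨((c, 1) : Γ × T) • z.1, fun t => by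
    obtain ⟨b, hb⟩ := z.2 t
    refine ⟨c * b * c⁻¹, ?_⟩
    nth_rw 2 [← hb]
    simp [smul_smul]⟩
  one_smul z := Subtype.ext (one_smul (Γ × T) z.1)
  mul_smul a b z := Subtype.ext (by
    change (a * b, (1 : T)) • (z.1 : Z.carrier) = (a, (1 : T)) • (b, (1 : T)) • (z.1 : Z.carrier)
    simp [smul_smul])

instance (Z : FinGSet (Γ × T)) : Finite (StablePoint Z) :=
  inferInstanceAs (Finite {z : Z.carrier // ∀ t, ∃ c : Γ, ((c, t) : Γ × T) • z = z})

theorem fixCount_cls_eq_sum [Finite Γ] (Z : FinGSet (Γ × T)) [Fintype Γ] :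
    fixCount F Γ T (cls F Z) = ∑ c : Γ,
      (Nat.card {z : Z.carrier // ((c, 1) : Γ × T) • z = z ∧
        ∀ t, ∃ c' : Γ, ((c', t) : Γ × T) • z = z} : F) := by
  rw [fixCount, LinearMap.sum_apply]
  simp only [stabCount_cls, MulAction.mem_stabilizer_iff]
  refine Finset.sum_congr ?_ fun _ _ => rfl
  ext
  simp

/-- The orbit counting lemma applied to `Γ` acting on `StablePoint Z`. -/
theorem fixCount_cls [Finite Γ] (Z : FinGSet (Γ × T)) :
    fixCount F Γ T (cls F Z) =
      (Nat.card (MulAction.orbitRel.Quotient Γ (StablePoint Z)) * Nat.card Γ : F) := by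
  have := Fintype.ofFinite Γ
  rw [fixCount_cls_eq_sum, ← Nat.cast_mul, ← Nat.card_prod,
    ← Nat.card_congr (MulAction.sigmaFixedByEquivOrbitsProdGroup Γ (StablePoint Z)),
    Nat.card_sigma, Nat.cast_sum]
  refine Finset.sum_congr rfl fun c _ => ?_
  congr 1
  refine Nat.card_congr ⟨fun z => ⟨⟨z.1, z.2.2⟩, Subtype.ext z.2.1⟩,
    fun z => ⟨z.1.1, congrArg Subtype.val z.2, z.1.2⟩, fun _ => rfl, fun _ => rfl⟩

/-- The map `f` induces a `T`-equivariant bijection of orbit sets `Γ \ Z ≅ Γ' \ Z'`, hence a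
bijection of `T`-fixed points. It is stated for different groups since a factor of `Γ` is often
divided out first. -/
theorem card_orbits_congr {Γ' : Type u} [Group Γ'] (Z : FinGSet (Γ × T)) (Z' : FinGSet (Γ' × T))
    (f : Z.carrier → Z'.carrier)
    (hf : ∀ x y, (∃ c : Γ, (c, (1 : T)) • x = y) ↔ ∃ c : Γ', (c, (1 : T)) • f x = f y)
    (hsurj : ∀ z, ∃ x, ∃ c : Γ', (c, (1 : T)) • f x = z)
    (hT : ∀ (t : T) x, f (((1, t) : Γ × T) • x) = ((1, t) : Γ' × T) • f x) :
    Nat.card (MulAction.orbitRel.Quotient Γ (StablePoint Z)) =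
      Nat.card (MulAction.orbitRel.Quotient Γ' (StablePoint Z')) := by
  have hst (x : Z.carrier) (t : T) :
      (∃ c : Γ, ((c, t) : Γ × T) • x = x) ↔ ∃ c : Γ', ((c, t) : Γ' × T) • f x = f x := by
    have h1 := hf (((1, t) : Γ × T) • x) x
    rw [hT] at h1
    simpa [smul_smul] using h1
  have h11 (x : Z'.carrier) : ((1, 1) : Γ' × T) • x = x := one_smul (Γ' × T) x
  let g (x : StablePoint Z) : StablePoint Z' := ⟨f x.1, fun t => (hst x.1 t).1 (x.2 t)⟩
  refine Nat.card_congr (Equiv.ofBijective (Quotient.map g ?_) ⟨?_, ?_⟩)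
  · rintro x y ⟨c, hc⟩
    obtain ⟨c', hc'⟩ := (hf y.1 x.1).1 ⟨c, congrArg Subtype.val hc⟩
    exact ⟨c', Subtype.ext hc'⟩
  · rintro ⟨x⟩ ⟨y⟩ h
    obtain ⟨c', hc'⟩ := Quotient.exact h
    obtain ⟨c, hc⟩ := (hf y.1 x.1).2 ⟨c', congrArg Subtype.val hc'⟩
    exact Quotient.sound ⟨c, Subtype.ext hc⟩
  · rintro ⟨z⟩
    obtain ⟨x, c, hc⟩ := hsurj z.1
    refine ⟨Quotient.mk _ ⟨x, fun t => (hst x t).2 ?_⟩, Quotient.sound ⟨c⁻¹, Subtype.ext ?_⟩⟩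
    · obtain ⟨b, hb⟩ := z.2 t
      rw [← hc, smul_smul] at hb
      refine ⟨c⁻¹ * b * c, ?_⟩
      have := congrArg ((c⁻¹, (1 : T)) • ·) hb
      simpa [smul_smul, mul_assoc, h11] using this
    · change (c⁻¹, (1 : T)) • z.1 = f x
      rw [← hc, smul_smul]
      simp [h11]

end FixCount

/-! ### Pointwise cancellation in Möbius sums of orbit counts. -/

section Vanishing

open scoped Pointwise

variable {A T L : Type u} [Group A] [Group T] [Group L]

/-- The image in `L` of the stabilizer in `A` of a point. -/
def stabImage (π : A →* L) (W : FinGSet (A × T)) (z : W.carrier) : Subgroup L :=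
  ((MulAction.stabilizer (A × T) z).comap (MonoidHom.inl A T)).map π

open scoped Classical in
/-- For a point `z`, the contributions of the subgroups `X` of `L` to the number of `T`-fixed
orbits of `π⁻¹(X)` cancel. -/
theorem sum_moebius_mul_card_eq_zero [Finite A] [Finite L] [Fintype (Subgroup L)] {ν : Subgroup L → ℚ}
    (hν : IsMoebius ν) (π : A →* L) (W : FinGSet (A × T)) (z : W.carrier)
    (hz : (∀ l : L, ∃ a t, π a = l ∧ ((a, t) : A × T) • z = z) →
      ∑ X ∈ Finset.univ.filter fun X : Subgroup L =>
        (X : Set L) * (stabImage π W z : Set L) = Set.univ, (Nat.card X : ℚ) * ν X = 0) :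
    ∑ X, ν X * (if ∀ t : T, ∃ b : A, π b ∈ X ∧ (b, t) • z = z then
      (Nat.card {a : A // π a ∈ X ∧ (a, (1 : T)) • z = z} : ℚ) else 0) = 0 := by
  set R : Subgroup L := ((MulAction.stabilizer (A × T) z).map (MonoidHom.fst A T)).map π
  have hmem {a : A} {t : T} (h : (a, t) • z = z) : π a ∈ R := ⟨a, ⟨(a, t), h, rfl⟩, rfl⟩
  by_cases hR : R = ⊤
  · have hR' (l : L) : ∃ a t, π a = l ∧ ((a, t) : A × T) • z = z := by
      obtain ⟨_, ⟨⟨a, t⟩, h, rfl⟩, rfl⟩ : l ∈ R := hR ▸ Subgroup.mem_top l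
      exact ⟨a, t, rfl, h⟩
    by_cases hT : ∀ t : T, ∃ a : A, (a, t) • z = z
    -- Two elements of the stabilizer of `z` with the same `T`-component differ by an element of `A`
    -- fixing `z`.
    · have hiff (X : Subgroup L) : (∀ t : T, ∃ b : A, π b ∈ X ∧ (b, t) • z = z) ↔
          (X : Set L) * (stabImage π W z : Set L) = Set.univ := by
        constructor
        · refine fun h => Set.eq_univ_of_forall fun l => ?_
          obtain ⟨a, t, rfl, ha⟩ := hR' l
          obtain ⟨b, hb, hbz⟩ := h t
          refine ⟨π b, hb, π (b⁻¹ * a), ⟨b⁻¹ * a, ?_, rfl⟩, by simp⟩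
          change (b⁻¹ * a, (1 : T)) • z = z
          have : ((b, t)⁻¹ * (a, t)) • z = z := by
            rw [mul_smul, ha, inv_smul_eq_iff, hbz]
          simpa using this
        · intro h t
          obtain ⟨a, ha⟩ := hT t
          obtain ⟨x, hx, _, ⟨s, hs, rfl⟩, e⟩ := Set.mem_mul.1 (h ▸ Set.mem_univ (π a))
          refine ⟨a * s⁻¹, ?_, ?_⟩
          · rw [map_mul, ← e, map_inv, mul_inv_cancel_right]
            exact hx
          · have hs' : (s, (1 : T)) • z = z := hs
            have : ((a, t) * (s, (1 : T))⁻¹) • z = z := by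
              rw [mul_smul, inv_smul_eq_iff.2 hs'.symm, ha]
            simpa using this
      set S : Subgroup A := (MulAction.stabilizer (A × T) z).comap (MonoidHom.inl A T)
      have hrange : (π.comp S.subtype).range = stabImage π W z := by
        rw [MonoidHom.range_comp, Subgroup.range_subtype]
        rfl
      -- The count is the order of the preimage of `X` in the stabilizer of `z` in `A`, so it is
      -- proportional to `|X|`.
      have hcard (X : Subgroup L) (h : (X : Set L) * (stabImage π W z : Set L) = Set.univ) :
          (Nat.card {a : A // π a ∈ X ∧ (a, (1 : T)) • z = z} : ℚ) =
            Nat.card S / Nat.card L * Nat.card X := by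
        have h1 := card_comap_mul_card (π.comp S.subtype) X (by rw [hrange, h])
        have h2 : Nat.card (X.comap (π.comp S.subtype)) =
            Nat.card {a : A // π a ∈ X ∧ (a, (1 : T)) • z = z} :=
          Nat.card_congr ⟨fun a => ⟨a.1.1, a.2, a.1.2⟩, fun a => ⟨⟨a.1, a.2.2⟩, a.2.1⟩,
            fun _ => rfl, fun _ => rfl⟩
        have h3 := congrArg (Nat.cast : ℕ → ℚ) (h2 ▸ h1)
        push_cast at h3
        have : (Nat.card L : ℚ) ≠ 0 := by exact_mod_cast Nat.card_pos.ne'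
        field_simp
        linarith
      have h0 := congrArg ((Nat.card S / Nat.card L : ℚ) * ·) (hz hR')
      simp only [mul_zero, Finset.mul_sum, Finset.sum_filter] at h0
      refine Eq.trans ?_ h0
      refine Finset.sum_congr rfl fun X _ => ?_
      simp only [hiff]
      split_ifs with h
      · rw [hcard X h]
        ring
      · ring
    · push Not at hT
      obtain ⟨t, ht⟩ := hT
      refine Finset.sum_eq_zero fun X _ => ?_
      rw [if_neg, mul_zero]
      intro h
      obtain ⟨b, -, hb⟩ := h t
      exact ht b hb
  -- Every element of `A` involved in fixing `z` has image in `R`, so only `X ∩ R` matters.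
  · refine Eq.trans ?_ (hν.sum_mul_inf hR fun X => if ∀ t : T, ∃ b : A, π b ∈ X ∧ (b, t) • z = z then
      (Nat.card {a : A // π a ∈ X ∧ (a, (1 : T)) • z = z} : ℚ) else 0)
    refine Finset.sum_congr rfl fun X _ => ?_
    have e (a : A) (t : T) : π a ∈ X ⊓ R ∧ (a, t) • z = z ↔ π a ∈ X ∧ (a, t) • z = z :=
      ⟨fun h => ⟨h.1.1, h.2⟩, fun h => ⟨⟨h.1, hmem h.2⟩, h.2⟩⟩
    simp only [e]

/-- The restriction of an `A × T`-set to `π⁻¹(X) × T`. -/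
def resComap (π : A →* L) (W : FinGSet (A × T)) (X : Subgroup L) : FinGSet (X.comap π × T) :=
  W.res ((X.comap π).subtype.prodMap (MonoidHom.id T))

/-- Pairs (group element, point) are counted point by point instead of element by element, so that
the sum over `X` can be taken with `z` fixed. -/
theorem sum_moebius_mul_fixCount_eq_zero (F : Type v) [Field F] [CharZero F] [Finite A] [Finite L]
    [Fintype (Subgroup L)] {ν : Subgroup L → ℚ}
    (hν : IsMoebius ν) (π : A →* L) (W : FinGSet (A × T))
    (hW : ∀ z : W.carrier, (∀ l : L, ∃ a t, π a = l ∧ ((a, t) : A × T) • z = z) →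
      ∃ N : Subgroup L, N.Normal ∧ N ≤ stabImage π W z ∧ mConst L N = 0) :
    ∑ X, (ν X : F) * fixCount F (X.comap π) T (cls F (resComap π W X)) = 0 := by
  classical
  have := Fintype.ofFinite W.carrier
  have hpt (X : Subgroup L) : fixCount F (X.comap π) T (cls F (resComap π W X)) =
      ((∑ z : W.carrier, if ∀ t : T, ∃ b : A, π b ∈ X ∧ (b, t) • z = z then
        (Nat.card {a : A // π a ∈ X ∧ (a, (1 : T)) • z = z} : ℚ) else 0 : ℚ) : F) := by
    have := Fintype.ofFinite (X.comap π)
    rw [fixCount_cls_eq_sum, ← Nat.cast_sum, ← Nat.card_sigma]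
    have : Nat.card (Σ c : X.comap π, {z : (resComap π W X).carrier //
        ((c, 1) : X.comap π × T) • z = z ∧
          ∀ t, ∃ c' : X.comap π, ((c', t) : X.comap π × T) • z = z}) =
        ∑ z : W.carrier, if ∀ t : T, ∃ b : A, π b ∈ X ∧ (b, t) • z = z then
        Nat.card {a : A // π a ∈ X ∧ (a, (1 : T)) • z = z} else 0 := by
      have e (z : W.carrier) : (if ∀ t : T, ∃ b : A, π b ∈ X ∧ (b, t) • z = z then
          Nat.card {a : A // π a ∈ X ∧ (a, (1 : T)) • z = z} else 0) =
          Nat.card {a : A // (π a ∈ X ∧ (a, (1 : T)) • z = z) ∧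
            ∀ t : T, ∃ b : A, π b ∈ X ∧ (b, t) • z = z} := by
        split_ifs with h
        · simp [h]
        · simp [h]
      simp only [e]
      rw [← Nat.card_sigma]
      exact Nat.card_congr
        ⟨fun p => ⟨p.2.1, p.1.1, ⟨p.1.2, p.2.2.1⟩, fun t =>
            (p.2.2.2 t).imp' Subtype.val fun b hb => ⟨b.2, hb⟩⟩,
          fun p => ⟨⟨p.2.1, p.2.2.1.1⟩, p.1, p.2.2.1.2, fun t =>
            let ⟨b, hb⟩ := p.2.2.2 t; ⟨⟨b, hb.1⟩, hb.2⟩⟩,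
          fun _ => rfl, fun _ => rfl⟩
    rw [this, Nat.cast_sum, Rat.cast_sum]
    refine Finset.sum_congr rfl fun z _ => ?_
    split_ifs <;> simp
  simp only [hpt]
  simp only [← Rat.cast_mul, ← Rat.cast_sum]
  rw [Rat.cast_eq_zero]
  simp only [Finset.mul_sum]
  rw [Finset.sum_comm]
  refine Finset.sum_eq_zero fun z _ => sum_moebius_mul_card_eq_zero hν π W z fun h => ?_
  obtain ⟨N, hN, hle, h0⟩ := hW z h
  refine hν.sum_mul_eq_univ_eq_zero N _ hle ?_
  rw [hν.unique IsMoebius.top]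
  exact (mConst_eq_zero_iff N).1 h0

end Vanishing

namespace Burnside

@[simp] theorem res_cls (F : Type v) [Field F] {A B : Type u} [Group A] [Group B] (f : A →* B)
    (X : FinGSet B) : res F f (cls F X) = cls F (X.res f) :=
  lift_cls _ _ _ X

@[simp] theorem map_cls (F : Type v) [Field F] {H G : Type u} [Group H] [Group G]
    (U : FinBiset H G) (X : FinGSet G) : map F U (cls F X) = cls F (U.tensor X) :=
  lift_cls _ _ _ X

@[simp] theorem extProd_cls (F : Type v) [Field F] {A B : Type u} [Group A] [Group B]
    (X : FinGSet A) (Y : FinGSet B) : extProd F A B (cls F X) (cls F Y) = cls F (X.prod Y) := by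
  rw [extProd, lift_cls, lift_cls]

end Burnside

/-! ### The ideal cut out by the orbit counting forms -/

section TwistCount

variable (F : Type v) [Field F] {K G Γ T : Type u} [Group K] [Group G] [Group Γ] [Group T]

/-- The `Γ × T`-set `V × Y`, where `Γ` and `T` act on `Y` through `γ` and `κ`. -/
def twist (γ : Γ →* G) (κ : T →* K) (V : FinGSet (Γ × T)) (Y : FinGSet (G × K)) :
    FinGSet (Γ × T) :=
  (V.prod Y).res ((MonoidHom.id (Γ × T)).prod (γ.prodMap κ))

/-- The linear form on `FB_K(G)` counting, up to the factor `|Γ|`, the `T`-fixed points of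
`Γ \ (V × Y)`. -/
noncomputable def twistCount [Finite Γ] (γ : Γ →* G) (κ : T →* K) (V : FinGSet (Γ × T)) :
    Shifted F K G →ₗ[F] F :=
  fixCount F Γ T ∘ₗ res F ((MonoidHom.id (Γ × T)).prod (γ.prodMap κ)) ∘ₗ
    extProd F (Γ × T) (G × K) (cls F V)

theorem twistCount_cls [Finite Γ] (γ : Γ →* G) (κ : T →* K) (V : FinGSet (Γ × T))
    (Y : FinGSet (G × K)) :
    twistCount F γ κ V (cls F Y) = fixCount F Γ T (cls F (twist γ κ V Y)) := by
  simp [twistCount, twist]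

/-- The `(Γ × G) × T`-set `V × U`, for an `(H, G)`-biset `U` and `γ : Γ → H`. -/
def bisetTwist {H : Type u} [Group H] (γ : Γ →* H) (V : FinGSet (Γ × T)) (U : FinBiset H G) :
    FinGSet ((Γ × G) × T) where
  carrier := V.carrier × U.carrier
  action :=
    { smul := fun a z => (((a.1.1, a.2) : Γ × T) • z.1,
        γ a.1.1 • MulOpposite.op a.1.2⁻¹ • z.2)
      one_smul := fun z => Prod.ext (one_smul (Γ × T) z.1) (by
        change γ 1 • MulOpposite.op (1 : G)⁻¹ • z.2 = z.2
        simp)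
      mul_smul := fun a b z => Prod.ext
        (mul_smul ((a.1.1, a.2) : Γ × T) ((b.1.1, b.2) : Γ × T) z.1) (by
        change γ (a.1.1 * b.1.1) • MulOpposite.op (a.1.2 * b.1.2)⁻¹ • z.2 =
          γ a.1.1 • MulOpposite.op a.1.2⁻¹ • γ b.1.1 • MulOpposite.op b.1.2⁻¹ • z.2
        rw [← smul_comm (γ b.1.1) (MulOpposite.op a.1.2⁻¹), map_mul, mul_smul, smul_smul
          (MulOpposite.op a.1.2⁻¹), ← MulOpposite.op_mul, mul_inv_rev]) }

variable {F}

/-- The orbit sets `Γ \ (V × ((U × K) ×_{G × K} Y))` and `(Γ × G) \ (V × U × Y)` agree as `T`-sets: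
each class has a representative with `K`-component `1`. The factor `|G|` compares the normalizations
`|Γ|` and `|Γ × G|`. -/
theorem card_smul_twistCount_map [Finite Γ] [Finite G] [Finite K] {H : Type u} [Group H]
    (γ : Γ →* H) (κ : T →* K) (V : FinGSet (Γ × T)) (U : FinBiset H G) (a : Shifted F K G) :
    (Nat.card G : F) * twistCount F γ κ V (Shifted.map F K U a) =
      twistCount F (MonoidHom.snd Γ G) κ (bisetTwist γ V U) a := by
  suffices (Nat.card G : F) • (twistCount F γ κ V ∘ₗ Shifted.map F K U) =
      twistCount F (MonoidHom.snd Γ G) κ (bisetTwist γ V U) from LinearMap.congr_fun this a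
  refine hom_ext fun Y => ?_
  rw [LinearMap.smul_apply, LinearMap.comp_apply, Shifted.map, map_cls, twistCount_cls,
    twistCount_cls, fixCount_cls, fixCount_cls,
    card_orbits_congr (Γ' := Γ) (T := T) (twist (MonoidHom.snd Γ G) κ (bisetTwist γ V U) Y)
      (twist γ κ V ((U.prodGroup K).tensor Y))
      (fun z : (V.carrier × U.carrier) × Y.carrier =>
        (z.1.1, Quotient.mk ((U.prodGroup K).tensorSetoid Y) ((z.1.2, (1 : K)), z.2))), Nat.card_prod, smul_eq_mul]
  · push_cast
    ring
  · rintro ⟨⟨v, w⟩, y⟩ ⟨⟨v', w'⟩, y'⟩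
    constructor
    · rintro ⟨⟨c, g⟩, h⟩
      obtain ⟨h1, rfl⟩ := Prod.mk.inj h
      obtain ⟨rfl, rfl⟩ := Prod.mk.inj h1
      refine ⟨c, Prod.ext rfl (Quotient.sound ⟨(g⁻¹, 1), ?_⟩)⟩
      refine Prod.ext (Prod.ext ?_ ?_) ?_
      · exact smul_comm (γ c) (MulOpposite.op g⁻¹) w
      · change (1 : K) = κ 1 * 1 * 1
        simp
      · change ((g, κ 1) : G × K) • y = ((g⁻¹, (1 : K))⁻¹ : G × K) • y
        simp
    · rintro ⟨c, h⟩
      obtain ⟨rfl, h2⟩ := Prod.mk.inj h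
      obtain ⟨⟨g, k⟩, h3⟩ := Quotient.exact h2
      obtain ⟨h4, rfl⟩ := Prod.mk.inj h3
      obtain ⟨rfl, h5⟩ := Prod.mk.inj h4
      have hk : k = 1 := by
        have : (1 : K) = κ 1 * 1 * k := h5
        simpa using this.symm
      subst hk
      refine ⟨(c, g⁻¹), ?_⟩
      refine Prod.ext (Prod.ext rfl ?_) ?_
      · change γ c • MulOpposite.op g⁻¹⁻¹ • w = MulOpposite.op g • γ c • w
        rw [inv_inv]
        exact smul_comm (γ c) (MulOpposite.op g) w
      · change ((g⁻¹, κ 1) : G × K) • y = ((g, (1 : K))⁻¹ : G × K) • y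
        simp
  · rintro ⟨v, ⟨⟨w, k⟩, y⟩⟩
    refine ⟨((v, w), ((1, k) : G × K) • y), 1, Prod.ext (one_smul (Γ × T) v) ?_⟩
    refine Quotient.sound ⟨(1, k), Prod.ext (Prod.ext ?_ ?_) ?_⟩
    · change w = MulOpposite.op (1 : G) • γ 1 • w
      simp
    · change k = κ 1 * 1 * k
      simp
    · change y = ((1, k) : G × K)⁻¹ • ((1, k) : G × K) • y
      rw [inv_smul_smul]
  · rintro t ⟨⟨v, w⟩, y⟩
    refine Prod.ext rfl (Quotient.sound ⟨(1, κ t), Prod.ext (Prod.ext ?_ ?_) ?_⟩)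
    · change γ 1 • w = MulOpposite.op (1 : G) • γ 1 • MulOpposite.op (1 : G)⁻¹ • w
      simp
    · change κ t * 1 = 1 * κ t
      simp
    · change y = ((1, κ t) : G × K)⁻¹ • ((1, κ t) : G × K) • y
      rw [inv_smul_smul]

theorem twistCount_prod_cls [Finite Γ] {H : Type u} [Group H] (γ : Γ →* G × H) (κ : T →* K)
    (V : FinGSet (Γ × T)) (X : FinGSet (G × K)) (b : Shifted F K H) :
    twistCount F γ κ V (Shifted.prod F K G H (cls F X) b) =
      twistCount F ((MonoidHom.snd G H).comp γ) κ
        (twist ((MonoidHom.fst G H).comp γ) κ V X) b := by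
  suffices twistCount F γ κ V ∘ₗ res F (diagHom K G H) ∘ₗ extProd F (G × K) (H × K) (cls F X) =
      twistCount F ((MonoidHom.snd G H).comp γ) κ
        (twist ((MonoidHom.fst G H).comp γ) κ V X) from LinearMap.congr_fun this b
  refine hom_ext fun Y => ?_
  simp only [LinearMap.comp_apply, extProd_cls, res_cls, twistCount_cls]
  congr 1
  exact cls_eq_of_iso F ⟨(Equiv.prodAssoc _ _ _).symm, fun _ _ => rfl⟩

theorem twistCount_prod_eq_zero [Finite Γ] {H : Type u} [Group H] (γ : Γ →* G × H) (κ : T →* K)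
    (V : FinGSet (Γ × T)) (a : Shifted F K G) (b : Shifted F K H)
    (hb : ∀ X : FinGSet (G × K), twistCount F ((MonoidHom.snd G H).comp γ) κ
      (twist ((MonoidHom.fst G H).comp γ) κ V X) b = 0) :
    twistCount F γ κ V (Shifted.prod F K G H a b) = 0 := by
  suffices twistCount F γ κ V ∘ₗ res F (diagHom K G H) ∘ₗ (extProd F (G × K) (H × K)).flip b = 0
    from LinearMap.congr_fun this a
  exact hom_ext fun X => (twistCount_prod_cls γ κ V X b).trans (hb X)

end TwistCount

/-- The ideal of `FB_K` on which all the orbit counting forms vanish for which the group `(T, κ)`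
over `K` satisfies `O^p(T) ∩ ker κ = 1`. -/
noncomputable def fixIdeal (F : Type v) [Field F] [CharZero F] (p : ℕ) (K : Type u) [Group K]
    [Finite K] : ShiftedIdeal F K where
  obj G _ _ :=
    { carrier := {a | ∀ (Γ T : Type u) [Group Γ] [Group T] [Finite Γ] [Finite T] (γ : Γ →* G)
        (κ : T →* K) (V : FinGSet (Γ × T)), Op p T ⊓ κ.ker = ⊥ → twistCount F γ κ V a = 0}
      add_mem' := fun ha hb Γ T _ _ _ _ γ κ V h => by
        rw [map_add, ha Γ T γ κ V h, hb Γ T γ κ V h, add_zero]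
      zero_mem' := fun _ _ _ _ _ _ _ _ _ _ => map_zero _
      smul_mem' := fun c a ha Γ T _ _ _ _ γ κ V h => by
        rw [map_smul, ha Γ T γ κ V h, smul_zero] }
  map_mem {G H} _ _ _ _ U a ha Γ T _ _ _ _ γ κ V h := by
    have h1 := card_smul_twistCount_map γ κ V U a
    -- Only `Γ` and `V` have changed, so the condition on `(T, κ)` still holds.
    rw [ha (Γ × G) T _ κ _ h] at h1
    exact (mul_eq_zero.1 h1).resolve_left (by exact_mod_cast Nat.card_pos.ne')
  prod_mem a b hb Γ T _ _ _ _ γ κ V h :=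
    twistCount_prod_eq_zero γ κ V a b fun X => hb Γ T _ κ _ h

/-! ### Vanishing at `p`-groups -/

section PGroup

variable {F : Type v} [Field F] {p : ℕ} {K : Type u} [Group K]

/-- The finite group `P` with the action of `P × T` given by `(c, t) · v = ρ(t) v c⁻¹`. -/
def regularTwist {P T : Type u} [Group P] [Finite P] [Group T] (ρ : T →* P) :
    FinGSet (P × T) where
  carrier := P
  action :=
    { smul := fun a v => ρ a.2 * v * a.1⁻¹
      one_smul := fun v => by
        change ρ 1 * v * 1⁻¹ = v
        simp
      mul_smul := fun a b v => by
        change ρ (a.2 * b.2) * v * (a.1 * b.1)⁻¹ = ρ a.2 * (ρ b.2 * v * b.1⁻¹) * a.1⁻¹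
        simp [mul_assoc] }

/-- The map `(v, z) ↦ (v, 1) z` identifies `P \ (P × Z)` with `Z` as a `Y`-set, so the fixed points
counted are those of `Y` on `Z`. -/
theorem twistCount_regularTwist {P : Type u} [Group P] [Finite P] (Y : Subgroup (P × K))
    (a : Shifted F K P) :
    twistCount F (MonoidHom.id P) ((MonoidHom.snd P K).comp Y.subtype)
      (regularTwist ((MonoidHom.fst P K).comp Y.subtype)) a =
      Nat.card P * stabCount F (Y ≤ ·) a := by
  suffices twistCount F (MonoidHom.id P) ((MonoidHom.snd P K).comp Y.subtype)
      (regularTwist ((MonoidHom.fst P K).comp Y.subtype)) =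
      (Nat.card P : F) • stabCount F (Y ≤ ·) from LinearMap.congr_fun this a
  refine hom_ext fun Z => ?_
  -- Over the trivial group, orbits are points.
  let Z' : FinGSet (PUnit.{u + 1} × Y) := Z.res (Y.subtype.comp (MonoidHom.snd _ _))
  rw [twistCount_cls, fixCount_cls, LinearMap.smul_apply, smul_eq_mul, mul_comm,
    card_orbits_congr _ Z' (fun z : P × Z.carrier => (((z.1, 1) : P × K) • z.2 : Z.carrier))]
  · congr 1
    have h1 := fixCount_cls F Z'
    rw [Nat.card_unique (α := PUnit.{u + 1}), Nat.cast_one, mul_one] at h1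
    rw [← h1, fixCount_cls_eq_sum, stabCount_cls, Fintype.sum_unique]
    congr 1
    refine Nat.card_congr (Equiv.subtypeEquivRight fun z => ?_)
    constructor
    · rintro ⟨-, h⟩ y hy
      obtain ⟨_, h⟩ := h ⟨y, hy⟩
      exact h
    · exact fun h => ⟨one_smul (P × K) (α := Z.carrier) z, fun t => ⟨1, h t.2⟩⟩
  · rintro ⟨(v : P), (y : Z.carrier)⟩ ⟨(v' : P), (y' : Z.carrier)⟩
    constructor
    · rintro ⟨c, h⟩
      obtain ⟨h1, rfl⟩ := Prod.mk.inj h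
      have h2 : 1 * v * c⁻¹ = v' := h1
      subst h2
      refine ⟨1, ?_⟩
      have h2 : (1 : P × K) • ((v, 1) : P × K) • y =
          ((1 * v * c⁻¹, 1) : P × K) • ((c, 1) : P × K) • y := by
        simp [smul_smul]
      exact h2
    · rintro ⟨_, h⟩
      have h1 : (1 : P × K) • ((v, 1) : P × K) • y = ((v', 1) : P × K) • y' := h
      refine ⟨v'⁻¹ * v, Prod.ext ?_ ?_⟩
      · change 1 * v * (v'⁻¹ * v)⁻¹ = v'
        simp
      · change ((v'⁻¹ * v, 1) : P × K) • y = y'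
        rw [one_smul, ← inv_smul_eq_iff, smul_smul] at h1
        simpa using h1
  · exact fun (y : Z.carrier) => ⟨((1 : P), y), 1, by
      change (1 : P × K) • (1 : P × K) • y = y
      simp⟩
  · rintro t ⟨(v : P), (y : Z.carrier)⟩
    change ((t.1.1 * v * 1⁻¹, 1) : P × K) • ((1, t.1.2) : P × K) • y =
      (t.1 : P × K) • ((v, 1) : P × K) • y
    simp only [smul_smul]
    congr 1
    ext <;> simp

theorem _root_.IsPGroup.eq_one_of_coprime_orderOf [Fact p.Prime] {P : Type u} [Group P]
    (hP : IsPGroup p P) {x : P} (hx : (orderOf x).Coprime p) : x = 1 := by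
  obtain ⟨k, hk⟩ := IsPGroup.iff_orderOf.1 hP x
  rw [← orderOf_eq_one_iff, ← Nat.coprime_self]
  nth_rw 2 [hk]
  exact hx.pow_right k

theorem fixIdeal_obj_eq_bot [CharZero F] [Finite K] [Fact p.Prime] {P : Type u} [Group P] [Finite P]
    (hP : IsPGroup p P) : (fixIdeal F p K).obj P = ⊥ := by
  refine (Submodule.eq_bot_iff _).2 fun a ha => eq_zero_of_stabCount_le_eq_zero a fun Y => ?_
  have h := ha P Y (MonoidHom.id P) ((MonoidHom.snd P K).comp Y.subtype)
    (regularTwist ((MonoidHom.fst P K).comp Y.subtype)) ?_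
  · rw [twistCount_regularTwist] at h
    exact (mul_eq_zero.1 h).resolve_left (by exact_mod_cast Nat.card_pos.ne')
  -- The projection to the `p`-group `P` kills `O^p(Y)`, so an element of it also killed by the
  -- projection to `K` is trivial.
  · have hle : Op p Y ≤ ((MonoidHom.fst P K).comp Y.subtype).ker :=
      (Subgroup.closure_le _).2 fun y hy => hP.eq_one_of_coprime_orderOf
        (Nat.Coprime.coprime_dvd_left (orderOf_map_dvd _ y) hy)
    refine (Subgroup.eq_bot_iff_forall _).2 fun y hy => Subtype.ext (Prod.ext ?_ ?_)
    · exact hle hy.1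
    · exact hy.2

end PGroup

/-! ### The idempotent of a graph as a sum over subgroups of `L`. -/

section Graph

variable {K L : Type u} [Group K] [Group L]

/-- The homomorphism `l ↦ (l, φ(l))`, with image the graph of `φ`. -/
def graphHom (φ : L →* K) : L →* L × K := (MonoidHom.id L).prod φ

theorem graphHom_injective (φ : L →* K) : Function.Injective (graphHom φ) :=
  fun _ _ h => congrArg Prod.fst h

theorem range_graphHom (φ : L →* K) : (graphHom φ).range = φ.graph :=
  (MonoidHom.graph_eq_range_prod φ).symm

/-- The subgroups of `L × K` below the graph form a copy of the subgroup lattice of `L`. -/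
theorem isMoebius_graph [Finite K] [Finite L] [Fintype (Subgroup L)] (φ : L →* K) :
    IsMoebius fun X : Subgroup L => (subgroupMu (X.map (graphHom φ)) φ.graph : ℚ) := by
  classical
  have := Fintype.ofFinite (Subgroup (L × K))
  intro Y
  have h := congrArg (Int.cast : ℤ → ℚ) (sum_subgroupMu (Y.map (graphHom φ)) φ.graph)
  have e : Y.map (graphHom φ) = φ.graph ↔ Y = ⊤ := by
    rw [← range_graphHom, MonoidHom.range_eq_map]
    exact (Subgroup.map_injective (graphHom_injective φ)).eq_iff
  simp only [e] at h
  push_cast at h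
  refine Eq.trans ?_ h
  refine Finset.sum_bij (fun X _ => X.map (graphHom φ)) ?_ ?_ ?_ fun _ _ => rfl
  · intro X hX
    simp only [Finset.mem_filter, Finset.mem_univ, true_and] at hX ⊢
    exact ⟨Subgroup.map_mono hX, range_graphHom φ ▸ Subgroup.map_le_range _ X⟩
  · exact fun X _ X' _ h => Subgroup.map_injective (graphHom_injective φ) h
  · intro Z hZ
    simp only [Finset.mem_filter, Finset.mem_univ, true_and] at hZ
    refine ⟨Z.comap (graphHom φ), ?_, Subgroup.map_comap_eq_self (range_graphHom φ ▸ hZ.2)⟩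
    simpa [Subgroup.map_le_iff_le_comap] using hZ.1

theorem idem_graph (F : Type v) [Field F] [Finite K] [Finite L] [Fintype (Subgroup L)]
    (φ : L →* K) :
    idem F φ.graph = (Nat.card (Subgroup.normalizer (φ.graph : Set (L × K))) : F)⁻¹ •
      ∑ X : Subgroup L, ((Nat.card X : F) * (subgroupMu X ⊤ : F)) •
        cls F (FinGSet.coset (X.map (graphHom φ))) := by
  classical
  have := Fintype.ofFinite (Subgroup (L × K))
  have hmu (X : Subgroup L) : subgroupMu (X.map (graphHom φ)) φ.graph = subgroupMu X ⊤ := by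
    exact_mod_cast congrFun ((isMoebius_graph φ).unique IsMoebius.top) X
  have hcard (X : Subgroup L) : Nat.card (X.map (graphHom φ)) = Nat.card X :=
    Subgroup.card_map_of_injective (graphHom_injective φ)
  rw [idem, finsum_eq_sum_of_fintype]
  simp_rw [finsum_eq_if]
  rw [← Finset.sum_filter]
  congr 1
  symm
  refine Finset.sum_bij (fun X _ => X.map (graphHom φ)) ?_ ?_ ?_ ?_
  · intro X hX
    simp only [Finset.mem_filter, Finset.mem_univ, true_and]
    exact range_graphHom φ ▸ Subgroup.map_le_range _ X
  · exact fun X _ X' _ h => Subgroup.map_injective (graphHom_injective φ) h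
  · intro Z hZ
    simp only [Finset.mem_filter, Finset.mem_univ, true_and] at hZ
    exact ⟨Z.comap (graphHom φ), Finset.mem_univ _,
      Subgroup.map_comap_eq_self (range_graphHom φ ▸ hZ)⟩
  · intro X _
    rw [hmu, hcard]

end Graph

/-! ### Membership of the idempotent in `fixIdeal`. -/

section Membership

variable {K L Γ T : Type u} [Group K] [Group L] [Group Γ] [Group T]

/-- The `(Γ × L) × T`-set `V × (L × K)`, where `L` acts by right multiplication through the graph
of `φ`. -/
def graphTwist [Finite K] [Finite L] (φ : L →* K) (γ : Γ →* L) (κ : T →* K)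
    (V : FinGSet (Γ × T)) : FinGSet ((Γ × L) × T) where
  carrier := V.carrier × (L × K)
  action :=
    { smul := fun a z => (((a.1.1, a.2) : Γ × T) • z.1,
        (γ a.1.1, κ a.2) * z.2 * (graphHom φ a.1.2)⁻¹)
      one_smul := fun z => Prod.ext (one_smul (Γ × T) z.1) (by
        change (γ 1, κ 1) * z.2 * (graphHom φ 1)⁻¹ = z.2
        rw [map_one, map_one, map_one, ← Prod.one_eq_mk]
        simp)
      mul_smul := fun a b z => Prod.ext
        (mul_smul ((a.1.1, a.2) : Γ × T) ((b.1.1, b.2) : Γ × T) z.1) (by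
        change (γ (a.1.1 * b.1.1), κ (a.2 * b.2)) * z.2 * (graphHom φ (a.1.2 * b.1.2))⁻¹ =
          (γ a.1.1, κ a.2) * ((γ b.1.1, κ b.2) * z.2 * (graphHom φ b.1.2)⁻¹) *
            (graphHom φ a.1.2)⁻¹
        rw [map_mul, map_mul, map_mul, ← Prod.mk_mul_mk]
        group) }

/-- `(L × K) / X_φ` is the orbit set of `X` acting on `L × K` from the right, so `X` can be moved
into the acting group, which becomes `Γ × X`. The factor `|X|` of the Gluck-Yoshida formula is
exactly the change of normalization. -/
theorem card_mul_twistCount_coset (F : Type v) [Field F] [Finite Γ] [Finite K] [Finite L]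
    (φ : L →* K) (γ : Γ →* L) (κ : T →* K) (V : FinGSet (Γ × T)) (X : Subgroup L) :
    (Nat.card X : F) * twistCount F γ κ V (cls F (FinGSet.coset (X.map (graphHom φ)))) =
      fixCount F (X.comap (MonoidHom.snd Γ L)) T
        (cls F (resComap (MonoidHom.snd Γ L) (graphTwist φ γ κ V) X)) := by
  have hcard : Nat.card (X.comap (MonoidHom.snd Γ L)) = Nat.card Γ * Nat.card X := by
    rw [← Nat.card_prod]
    exact Nat.card_congr ⟨fun a => (a.1.1, ⟨a.1.2, a.2⟩), fun a => ⟨(a.1, a.2.1), a.2.2⟩,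
      fun _ => rfl, fun _ => rfl⟩
  rw [twistCount_cls, fixCount_cls, fixCount_cls, hcard,
    card_orbits_congr (Γ' := Γ) (T := T) (resComap (MonoidHom.snd Γ L) (graphTwist φ γ κ V) X)
      (twist γ κ V (FinGSet.coset (X.map (graphHom φ))))
      (fun z : V.carrier × (L × K) => (z.1, (z.2 : (L × K) ⧸ X.map (graphHom φ))))]
  · push_cast
    ring
  · rintro ⟨(v : V.carrier), (m : L × K)⟩ ⟨(v' : V.carrier), (m' : L × K)⟩
    constructor
    · rintro ⟨⟨⟨c, l⟩, hl⟩, h⟩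
      obtain ⟨rfl, h2⟩ := Prod.mk.inj h
      have h3 : (γ c, κ 1) * m * (graphHom φ l)⁻¹ = m' := h2
      refine ⟨c, Prod.ext rfl ?_⟩
      change ((((γ c, κ 1) : L × K) * m : L × K) : (L × K) ⧸ X.map (graphHom φ)) = m'
      rw [QuotientGroup.eq, ← h3]
      refine ⟨l⁻¹, inv_mem hl, ?_⟩
      rw [map_inv]
      group
    · rintro ⟨c, h⟩
      obtain ⟨rfl, h2⟩ := Prod.mk.inj h
      have h3 : ((((γ c, κ 1) : L × K) * m : L × K) : (L × K) ⧸ X.map (graphHom φ)) = m' := h2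
      rw [QuotientGroup.eq] at h3
      obtain ⟨l, hl, h4⟩ := h3
      refine ⟨⟨(c, l⁻¹), inv_mem hl⟩, Prod.ext rfl ?_⟩
      change (γ c, κ 1) * m * (graphHom φ l⁻¹)⁻¹ = m'
      rw [map_inv, inv_inv, h4]
      group
  · rintro ⟨(v : V.carrier), q⟩
    obtain ⟨m, rfl⟩ := QuotientGroup.mk_surjective q
    exact ⟨(v, m), 1, one_smul (Γ × T) _⟩
  · rintro t ⟨(v : V.carrier), (m : L × K)⟩
    refine Prod.ext rfl ?_
    change ((((γ 1, κ t) : L × K) * m * (graphHom φ 1)⁻¹ : L × K) : (L × K) ⧸ X.map (graphHom φ)) =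
      ((((γ 1, κ t) : L × K) * m : L × K) : (L × K) ⧸ X.map (graphHom φ))
    simp

theorem exists_pow_mem_Op (p : ℕ) [Fact p.Prime] [Finite T] (t : T) :
    ∃ a : ℕ, t ^ p ^ a ∈ Op p T := by
  obtain ⟨a, m, hm, h⟩ := Nat.exists_eq_pow_mul_and_not_dvd (n := orderOf t) (orderOf_pos t).ne' p
    (Nat.Prime.ne_one Fact.out)
  refine ⟨a, Subgroup.subset_closure ?_⟩
  have hp : 0 < p ^ a := pow_pos (Nat.Prime.pos Fact.out) a
  change (orderOf (t ^ p ^ a)).Coprime p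
  rw [orderOf_pow_of_dvd hp.ne' (h ▸ Dvd.intro _ rfl), h, Nat.mul_div_cancel_left _ hp]
  exact ((Nat.Prime.coprime_iff_not_dvd Fact.out).2 hm).symm

theorem Op_inf_ker_le_stabImage (p : ℕ) [Fact p.Prime] [Finite K] [Finite L] [Finite T]
    (φ : L →* K) (γ : Γ →* L) (κ : T →* K) (hκ : Op p T ⊓ κ.ker = ⊥) (V : FinGSet (Γ × T))
    (z : (graphTwist φ γ κ V).carrier)
    (hz : ∀ l : L, ∃ (a : Γ × L) (t : T), MonoidHom.snd Γ L a = l ∧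
      ((a, t) : (Γ × L) × T) • z = z) :
    Op p L ⊓ φ.ker ≤ stabImage (MonoidHom.snd Γ L) (graphTwist φ γ κ V) z := by
  let R : Subgroup L := (MulAction.stabilizer ((Γ × L) × T) z ⊓
    (Op p T).comap (MonoidHom.snd (Γ × L) T)).map
      ((MonoidHom.snd Γ L).comp (MonoidHom.fst (Γ × L) T))
  have hR : Op p L ≤ R := by
    refine (Subgroup.closure_le _).2 fun l hl => ?_
    obtain ⟨a, t, rfl, h⟩ := hz l
    obtain ⟨n, hn⟩ := exists_pow_mem_Op p t
    -- Since `l` has order prime to `p`, it is a power of `l ^ p ^ n`, whose lift has its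
    -- `T`-component in `O^p(T)`.
    obtain ⟨k, hk⟩ := exists_pow_eq_self_of_coprime (n := p ^ n)
      (Nat.Coprime.pow_left n (Nat.Coprime.symm hl))
    rw [← hk]
    exact R.pow_mem ⟨(a, t) ^ p ^ n,
      ⟨pow_mem (S := MulAction.stabilizer ((Γ × L) × T) z) h _, hn⟩, rfl⟩ k
  rintro l ⟨hl, hφ⟩
  obtain ⟨⟨⟨c, l⟩, t⟩, ⟨h, ht⟩, rfl⟩ := hR hl
  have h1 : (γ c, κ t) * (z.2 : L × K) * (graphHom φ l)⁻¹ = z.2 := congrArg Prod.snd h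
  -- In the `K`-coordinate, `φ l = 1` forces `κ t = 1`; hence `t = 1` and `l` comes from the
  -- stabilizer in `Γ × L`.
  have h2 : κ t * z.2.2 * (φ l)⁻¹ = z.2.2 := congrArg Prod.snd h1
  have h3 : φ l = 1 := hφ
  rw [h3, inv_one, mul_one, mul_eq_right] at h2
  have h4 : t ∈ Op p T ⊓ κ.ker := ⟨ht, h2⟩
  rw [hκ, Subgroup.mem_bot] at h4
  subst h4
  exact ⟨(c, l), h, rfl⟩

theorem idem_mem_fixIdeal (F : Type v) [Field F] [CharZero F] (p : ℕ) [Fact p.Prime]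
    [Finite K] [Finite L] (φ : L →* K) (h : mConst L (Op p L ⊓ φ.ker) = 0) :
    idem F φ.graph ∈ (fixIdeal F p K).obj L := by
  have := Fintype.ofFinite (Subgroup L)
  intro Γ T _ _ _ _ γ κ V hκ
  have h0 := sum_moebius_mul_fixCount_eq_zero F IsMoebius.top (MonoidHom.snd Γ L)
    (graphTwist φ γ κ V) fun z hz =>
      ⟨Op p L ⊓ φ.ker, inferInstance, Op_inf_ker_le_stabImage p φ γ κ hκ V z hz, h⟩
  rw [idem_graph, map_smul, map_sum, smul_eq_zero]
  right
  refine Eq.trans (Finset.sum_congr rfl fun X _ => ?_) h0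
  rw [map_smul, smul_eq_mul, ← card_mul_twistCount_coset, Rat.cast_intCast]
  ring

end Membership

/-! ### Evaluation at `L / O^p(L)` -/

section Deflation

variable {K L : Type u} [Group K] [Group L]

theorem isPGroup_quotient_Op (p : ℕ) [Fact p.Prime] [Finite L] : IsPGroup p (L ⧸ Op p L) := by
  intro q
  obtain ⟨l, rfl⟩ := QuotientGroup.mk_surjective q
  obtain ⟨a, ha⟩ := exists_pow_mem_Op p l
  exact ⟨a, (QuotientGroup.eq_one_iff _).2 ha⟩

/-- The `(L / N, L)`-biset `L / N`, which induces the deflation from `L` to `L / N`. -/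
def deflBiset [Finite L] (N : Subgroup L) [N.Normal] : FinBiset (L ⧸ N) L where
  carrier := L ⧸ N
  right :=
    { smul := fun l q => q * (l.unop : L ⧸ N)
      one_smul := fun q => mul_one q
      mul_smul := fun a b q => (mul_assoc q (b.unop : L ⧸ N) (a.unop : L ⧸ N)).symm }
  comm := ⟨fun a l q => (mul_assoc a q (l.unop : L ⧸ N)).symm⟩

theorem map_deflBiset_coset (F : Type v) [Field F] [Finite K] [Finite L] (φ : L →* K)
    (N : Subgroup L) [N.Normal] (X : Subgroup L) :
    Shifted.map F K (deflBiset N) (cls F (FinGSet.coset (X.map (graphHom φ)))) =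
      cls F (FinGSet.coset (X.map ((QuotientGroup.mk' N).prod φ))) := by
  rw [Shifted.map, map_cls]
  let U : FinBiset ((L ⧸ N) × K) (L × K) := (deflBiset N).prodGroup K
  let C : FinGSet (L × K) := FinGSet.coset (X.map (graphHom φ))
  let π : L × K →* (L ⧸ N) × K := (QuotientGroup.mk' N).prodMap (MonoidHom.id K)
  have hmap : X.map ((QuotientGroup.mk' N).prod φ) = (X.map (graphHom φ)).map π := by
    rw [Subgroup.map_map]
    rfl
  symm
  refine cls_eq_of_iso F ⟨Equiv.ofBijective (Quotient.lift (fun q : (L ⧸ N) × K =>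
    Quotient.mk (U.tensorSetoid C) (q, ((1 : L × K) : (L × K) ⧸ X.map (graphHom φ)))) ?_)
    ⟨?_, ?_⟩, ?_⟩
  · intro q q' h
    obtain ⟨x, hx, e⟩ : q⁻¹ * q' ∈ X.map ((QuotientGroup.mk' N).prod φ) :=
      QuotientGroup.leftRel_apply.1 h
    refine Quotient.sound ⟨graphHom φ x, Prod.ext ?_ ?_⟩
    · change q' = q * π (graphHom φ x)
      rw [eq_comm, ← eq_inv_mul_iff_mul_eq]
      exact e
    · change ((1 : L × K) : (L × K) ⧸ X.map (graphHom φ)) = (((graphHom φ x)⁻¹ * 1 : L × K) : _)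
      rw [QuotientGroup.eq]
      exact ⟨x⁻¹, inv_mem hx, by simp⟩
  · rintro ⟨q⟩ ⟨q'⟩ h
    obtain ⟨g, h1⟩ := Quotient.exact h
    have h2 : q' = q * π g := congrArg Prod.fst h1
    have h3 : ((1 : L × K) : (L × K) ⧸ X.map (graphHom φ)) = ((g⁻¹ * 1 : L × K) : _) :=
      congrArg Prod.snd h1
    rw [QuotientGroup.eq] at h3
    refine QuotientGroup.eq.2 ?_
    rw [h2, inv_mul_cancel_left, hmap]
    exact Subgroup.mem_map_of_mem π (by simpa using h3)
  · rintro ⟨(q : (L ⧸ N) × K), c⟩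
    obtain ⟨m, rfl⟩ := QuotientGroup.mk_surjective c
    refine ⟨((q * π m : (L ⧸ N) × K) : ((L ⧸ N) × K) ⧸ X.map ((QuotientGroup.mk' N).prod φ)),
      Quotient.sound (s := U.tensorSetoid C) ⟨m⁻¹, Prod.ext ?_ ?_⟩⟩
    · change q = q * π m * π m⁻¹
      simp
    · change ((m : L × K) : (L × K) ⧸ X.map (graphHom φ)) = ((m⁻¹⁻¹ * 1 : L × K) : _)
      simp
  · rintro g ⟨q⟩
    rfl

/-- The mark at `f(L)`, for `f : L → L / N × K`, detects the deflation: by orders, `f(L)` fixes a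
point of the coset space of `f(X)` only if `f(X) = f(L)`, that is, `X (N ∩ ker φ) = L`. The
surviving terms add up to a nonzero multiple of `m_{L, N ∩ ker φ}`. -/
theorem idem_deflation_ne_zero (F : Type v) [Field F] [CharZero F] [Finite K] [Finite L]
    (φ : L →* K) (N : Subgroup L) [N.Normal] (h : mConst L (N ⊓ φ.ker) ≠ 0) :
    Shifted.map F K (deflBiset N) (idem F φ.graph) ≠ 0 := by
  classical
  have := Fintype.ofFinite (Subgroup L)
  set f : L →* (L ⧸ N) × K := (QuotientGroup.mk' N).prod φ with hf
  have hker : f.ker = N ⊓ φ.ker := by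
    rw [hf, MonoidHom.ker_prod, QuotientGroup.ker_mk']
  have hcount (X : Subgroup L) :
      stabCount F (f.range ≤ ·) (cls F (FinGSet.coset (X.map f))) =
        if X ⊔ (N ⊓ φ.ker) = ⊤ then
          stabCount F (f.range ≤ ·) (cls F (FinGSet.coset f.range)) else 0 := by
    split_ifs with hX
    · have : X.map f = f.range := by
        rw [MonoidHom.range_eq_map, Subgroup.map_eq_map_iff, hker, hX, top_sup_eq]
      rw [this]
    · rw [stabCount_cls]
      have : IsEmpty {x : (FinGSet.coset (X.map f)).carrier //
          f.range ≤ MulAction.stabilizer ((L ⧸ N) × K) x} := by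
        refine ⟨fun x => hX ?_⟩
        have hle := (Subgroup.card_le_of_le x.2).trans_eq (card_stabilizer_coset (X.map f) x.1)
        have heq := Subgroup.eq_of_le_of_card_ge (Subgroup.map_le_range f X) hle
        rwa [MonoidHom.range_eq_map, Subgroup.map_eq_map_iff, hker, top_sup_eq] at heq
      rw [Nat.card_of_isEmpty, Nat.cast_zero]
  have hpos : stabCount F (f.range ≤ ·) (cls F (FinGSet.coset f.range)) ≠ 0 := by
    rw [stabCount_cls]
    have : Nonempty {x : (FinGSet.coset f.range).carrier //
        f.range ≤ MulAction.stabilizer ((L ⧸ N) × K) x} :=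
      ⟨((1 : (L ⧸ N) × K) : ((L ⧸ N) × K) ⧸ f.range), fun y hy =>
        QuotientGroup.eq.2 (by simpa using hy)⟩
    exact_mod_cast Nat.card_pos.ne'
  intro h0
  have h1 := congrArg (stabCount F (f.range ≤ ·)) h0
  rw [idem_graph] at h1
  simp only [map_smul, map_sum, map_zero, map_deflBiset_coset, ← hf, hcount, smul_eq_mul,
    mul_ite, mul_zero, ← Finset.sum_filter, ← Finset.sum_mul] at h1
  rw [mul_eq_zero, mul_eq_zero, or_iff_right (inv_ne_zero (by exact_mod_cast Nat.card_pos.ne')),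
    or_iff_left hpos] at h1
  refine h ((mConst_eq_zero_iff _).2 ?_)
  exact_mod_cast h1

end Deflation

/-! ### Generated ideals and the main theorem. -/

theorem ShiftedIdeal.generated_obj_le {F : Type v} [Field F] {K : Type u} [Group K] [Finite K]
    {L : Type u} [Group L] [Finite L] {a : Shifted F K L} {I : ShiftedIdeal F K}
    (h : a ∈ I.obj L) (G : Type u) [Group G] [Finite G] :
    (ShiftedIdeal.generated F K a).obj G ≤ I.obj G :=
  sInf_le ⟨I, h, rfl⟩

theorem ShiftedIdeal.mem_generated {F : Type v} [Field F] {K : Type u} [Group K] [Finite K]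
    {L : Type u} [Group L] [Finite L] (a : Shifted F K L) :
    a ∈ (ShiftedIdeal.generated F K a).obj L := by
  refine Submodule.mem_sInf.2 ?_
  rintro _ ⟨I, hI, rfl⟩
  exact hI

end RelBGroup

theorem mainTheorem11 {F : Type v} [Field F] [CharZero F] (p : ℕ) [Fact p.Prime]
    {K L : Type u} [Group K] [Finite K] [Group L] [Finite L] (φ : L →* K) :
    List.TFAE
      [RelBGroup.IsPersistent F p φ,
        (RelBGroup.eIdeal F φ).obj (L ⧸ RelBGroup.Op p L) ≠ ⊥,
        RelBGroup.mConst L (RelBGroup.Op p L ⊓ φ.ker) ≠ 0] ∧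
    (RelBGroup.IsPersistent F p φ → RelBGroup.IsBGroup φ →
      RelBGroup.Op p L ⊓ φ.ker = ⊥) := by
  have h13 : RelBGroup.IsPersistent F p φ → RelBGroup.mConst L (RelBGroup.Op p L ⊓ φ.ker) ≠ 0 := by
    rintro ⟨P, _, _, hP, hne⟩ h0
    refine hne (le_bot_iff.1 ?_)
    rw [← RelBGroup.fixIdeal_obj_eq_bot (F := F) (K := K) hP]
    exact RelBGroup.ShiftedIdeal.generated_obj_le (RelBGroup.idem_mem_fixIdeal F p φ h0) P
  refine ⟨?_, fun hp hB => ?_⟩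
  · tfae_have 1 → 3 := h13
    tfae_have 3 → 2 := fun h hbot => RelBGroup.idem_deflation_ne_zero F φ _ h
      ((Submodule.eq_bot_iff _).1 hbot _ ((RelBGroup.eIdeal F φ).map_mem _
        (RelBGroup.ShiftedIdeal.mem_generated _)))
    tfae_have 2 → 1 := fun h => ⟨_, inferInstance, inferInstance,
      RelBGroup.isPGroup_quotient_Op p, h⟩
    tfae_finish
  · by_contra hne
    exact h13 hp (hB _ inferInstance inf_le_right hne)
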